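/- Fix integers $p\ge 4$ and $t\ge 1$. A float is a real number $m2^e$ with integers $m,e$, $|m|<2^p$ (precision $p$, no underflow or overflow); let $\epsilon=2^{1-p}$ be the machine precision, and let $\mathrm{ulp}(a)=2^{\lfloor\log_2|a|\rfloor+1-p}$ for $a\neq 0$, $\mathrm{ulp}(0)=0$. A $t$-term floating-point expansion (FPE) is a sum $\tilde f=\tilde f_1+\dots+\tilde f_t$ of floats that is ulp-nonoverlapping, i.e. $|\tilde f_i|\le \mathrm{ulp}(\tilde f_{i-1})$ for $2\le i\le t$. A $t$-term FPE representation of $\mathbf x\in\mathbb R^n$ consists of one $t$-term FPE for each coordinate $x_i$, with error at most $\epsilon^t|x_i|$. There is a $t$-term FPE arithmetic, depending only on $p$ and $t$, with the following properties. It consists of routines for the sum of any finite number of FPEs and for the product and the quotient of two FPEs. Each routine is a finite computation with constants, comparisons and the ordinary float operations $+,-,\times,\div$ and fused multiply-add, each rounded to nearest (with any rule for ties). Each routine returns a $t$-term FPE whose relative error is at most $\epsilon^t$ (for the quotient, when the divisor is nonzero). Moreover, for every $n$ and all $\mathbf x,\mathbf y$ in the Poincaré ball $\mathbb D^n$ with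 $\|\mathbf x\|<1-\epsilon^{t-1}$ and $\|\mathbf y\|<1-\epsilon^{t-1}$, the following holds. Let $$z=1+2\,\frac{\|\mathbf x-\mathbf y\|^2}{(1-\|\mathbf x\|^2)(1-\|\mathbf y\|^2)},\qquad d_{\mathbb D}(\mathbf x,\mathbf y)=\cosh^{-1}(z),$$ and let $\tilde z=\tilde z_1+\dots+\tilde z_t$ be the result of evaluating this formula for $z$ in the $t$-term FPE arithmetic, starting from any $t$-term FPE representations of $\mathbf x$ and $\mathbf y$. Then $\tilde z$ is a $t$-term FPE and $\tilde z_1$ is its term of strictly largest magnitude. Let $A$ be any floating-point inverse hyperbolic cosine with accuracy $\epsilon_1^*$ on $[1,R]$, i.e. $|\cosh^{-1}(x)-A(\tilde x)|<\epsilon_1^*$ for all real $x\in[1,R]$ and all floats $\tilde x\in[1,R]$ with $|\tilde x-x|<\epsilon|x|$, and suppose that $2z\le R$ (no overflow). Then the largest-magnitude approximation $d=A(\tilde z_1)$ satisfies $$\left|\,d-\cosh^{-1}\left(1+2\,\frac{\|\mathbf x-\mathbf y\|^2}{(1-\|\mathbf x\|^2)(1-\|\mathbf y\|^2)}\right)\right|<\epsilon^*:=16\,\epsilon_1^*.$$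 -/

import Mathlib

noncomputable section

/-! ### Binary floating-point numbers -/

/-- Floating-point numbers with a `p`-bit significand (unbounded exponent range). -/
def IsFloat (p : ℕ) (a : ℝ) : Prop :=
  ∃ m e : ℤ, |m| < 2 ^ p ∧ a = (m : ℝ) * (2 : ℝ) ^ e

/-- Machine precision: the distance from `1` to the next float (`2⁻⁵²` for float64). -/
def machineEps (p : ℕ) : ℝ := (2 : ℝ) ^ (1 - (p : ℤ))

/-- Unit in the last place; `ulp 0 = 0`. -/
def ulp (p : ℕ) (a : ℝ) : ℝ :=
  if a = 0 then 0 else (2 : ℝ) ^ (Int.log 2 |a| + 1 - (p : ℤ))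

/-- `fl` rounds every real number to a nearest float; ties may be broken in any way. -/
def IsRoundToNearest (p : ℕ) (fl : ℝ → ℝ) : Prop :=
  ∀ a : ℝ, IsFloat p (fl a) ∧ ∀ b : ℝ, IsFloat p b → |a - fl a| ≤ |a - b|

/-! ### Computations with ordinary floating-point operations -/

/-- A finite computation with ordinary floating-point operations on float inputs labelled by `ι`:
dyadic constants, the four basic operations, fused multiply-add, and comparisons. -/
inductive FloatExpr (ι : Type) : Type
  | var (i : ι) : FloatExpr ι
  | const (m e : ℤ) : FloatExpr ι
  | add (a b : FloatExpr ι) : FloatExpr ι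
  | sub (a b : FloatExpr ι) : FloatExpr ι
  | mul (a b : FloatExpr ι) : FloatExpr ι
  | div (a b : FloatExpr ι) : FloatExpr ι
  | fma (a b c : FloatExpr ι) : FloatExpr ι
  | ifLE (a b c d : FloatExpr ι) : FloatExpr ι

open Classical in
/-- The result of a computation on the inputs `v`; each operation is rounded by `fl`. -/
def FloatExpr.eval {ι : Type} (fl : ℝ → ℝ) (v : ι → ℝ) : FloatExpr ι → ℝ
  | .var i => v i
  | .const m e => fl ((m : ℝ) * (2 : ℝ) ^ e)
  | .add a b => fl (a.eval fl v + b.eval fl v)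
  | .sub a b => fl (a.eval fl v - b.eval fl v)
  | .mul a b => fl (a.eval fl v * b.eval fl v)
  | .div a b => fl (a.eval fl v / b.eval fl v)
  | .fma a b c => fl (a.eval fl v * b.eval fl v + c.eval fl v)
  | .ifLE a b c d => if a.eval fl v ≤ b.eval fl v then c.eval fl v else d.eval fl v

/-! ### Floating-point expansions -/

/-- `f 0 + ⋯ + f (t - 1)` is a ulp-nonoverlapping floating-point expansion (FPE). -/
def IsFPE (p : ℕ) {t : ℕ} (f : Fin t → ℝ) : Prop :=
  (∀ i, IsFloat p (f i)) ∧
    ∀ i j : Fin t, (j : ℕ) = (i : ℕ) + 1 → |f j| ≤ ulp p (f i)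

/-- The real number that an expansion stands for. -/
def fpeValue {t : ℕ} (f : Fin t → ℝ) : ℝ := ∑ i, f i

/-- The expansion of a float: first term `c`, all other terms `0`. -/
def fpeOfFloat (t : ℕ) (c : ℝ) : Fin t → ℝ := fun i => if (i : ℕ) = 0 then c else 0

/-- `X` represents the point `x` by one `t`-term FPE per coordinate, with relative error at most
`ε ^ t` (zero error is the case in which the coordinates of `x` are themselves FPEs). -/
def IsFPERepr (p : ℕ) {t n : ℕ} (X : Fin n → Fin t → ℝ) (x : EuclideanSpace ℝ (Fin n)) : Prop :=
  ∀ i, IsFPE p (X i) ∧ |fpeValue (X i) - x i| ≤ machineEps p ^ t * |x i|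

/-! ### Arithmetic of `t`-term expansions -/

/-- Routines for `t`-term FPE arithmetic, each one a finite floating-point computation: the sum of
`n` expansions (merging and renormalizing), the product and the quotient of two expansions.
The input labelled `(k, j)` is the `j`-th term of the `k`-th operand. -/
structure FPERoutines (t : ℕ) where
  sum : (n : ℕ) → Fin t → FloatExpr (Fin n × Fin t)
  mul : Fin t → FloatExpr (Fin 2 × Fin t)
  div : Fin t → FloatExpr (Fin 2 × Fin t)

namespace FPERoutines

variable {t : ℕ} (𝓡 : FPERoutines t) (fl : ℝ → ℝ)

def runSum {n : ℕ} (a : Fin n → Fin t → ℝ) : Fin t → ℝ :=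
  fun j => (𝓡.sum n j).eval fl fun q => a q.1 q.2

def runAdd (a b : Fin t → ℝ) : Fin t → ℝ := 𝓡.runSum fl ![a, b]

/-- Subtraction; the sign change is exact and done term by term. -/
def runSub (a b : Fin t → ℝ) : Fin t → ℝ := 𝓡.runSum fl ![a, -b]

def runMul (a b : Fin t → ℝ) : Fin t → ℝ :=
  fun j => (𝓡.mul j).eval fl fun q => (![a, b] : Fin 2 → Fin t → ℝ) q.1 q.2

def runDiv (a b : Fin t → ℝ) : Fin t → ℝ :=
  fun j => (𝓡.div j).eval fl fun q => (![a, b] : Fin 2 → Fin t → ℝ) q.1 q.2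

/-- The routines perform addition, multiplication and division of `t`-term FPEs: whatever the
rounding to nearest, they send FPEs to FPEs, with relative error at most `ε ^ t`. -/
def IsAccurate (p : ℕ) : Prop :=
  ∀ fl : ℝ → ℝ, IsRoundToNearest p fl →
    (∀ (n : ℕ) (a : Fin n → Fin t → ℝ), (∀ i, IsFPE p (a i)) →
      IsFPE p (𝓡.runSum fl a) ∧
        |fpeValue (𝓡.runSum fl a) - ∑ i, fpeValue (a i)|
          ≤ machineEps p ^ t * |∑ i, fpeValue (a i)|) ∧
    (∀ a b : Fin t → ℝ, IsFPE p a → IsFPE p b →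
      IsFPE p (𝓡.runMul fl a b) ∧
        |fpeValue (𝓡.runMul fl a b) - fpeValue a * fpeValue b|
          ≤ machineEps p ^ t * |fpeValue a * fpeValue b|) ∧
    (∀ a b : Fin t → ℝ, IsFPE p a → IsFPE p b → fpeValue b ≠ 0 →
      IsFPE p (𝓡.runDiv fl a b) ∧
        |fpeValue (𝓡.runDiv fl a b) - fpeValue a / fpeValue b|
          ≤ machineEps p ^ t * |fpeValue a / fpeValue b|)

/-- The squared norm of a vector of FPEs. -/
def runSqNorm {n : ℕ} (a : Fin n → Fin t → ℝ) : Fin t → ℝ :=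
  𝓡.runSum fl fun i => 𝓡.runMul fl (a i) (a i)

/-- `1 + 2 ‖x - y‖² / ((1 - ‖x‖²) (1 - ‖y‖²))` evaluated in `t`-term FPE arithmetic. -/
def runDistArg {n : ℕ} (X Y : Fin n → Fin t → ℝ) : Fin t → ℝ :=
  𝓡.runAdd fl (fpeOfFloat t 1)
    (𝓡.runDiv fl
      (𝓡.runMul fl (fpeOfFloat t 2) (𝓡.runSqNorm fl fun i => 𝓡.runSub fl (X i) (Y i)))
      (𝓡.runMul fl
        (𝓡.runSub fl (fpeOfFloat t 1) (𝓡.runSqNorm fl X))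
        (𝓡.runSub fl (fpeOfFloat t 1) (𝓡.runSqNorm fl Y))))

end FPERoutines

/-! ### The Poincaré distance and the floating-point inverse hyperbolic cosine -/

/-- The argument of the inverse hyperbolic cosine in the Poincaré distance. -/
def poincareArg {n : ℕ} (x y : EuclideanSpace ℝ (Fin n)) : ℝ :=
  1 + 2 * (‖x - y‖ ^ 2 / ((1 - ‖x‖ ^ 2) * (1 - ‖y‖ ^ 2)))

/-- The distance of the Poincaré ball. -/
def poincareDist {n : ℕ} (x y : EuclideanSpace ℝ (Fin n)) : ℝ :=
  Real.arcosh (poincareArg x y)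

/-- `A` is a floating-point inverse hyperbolic cosine on the range `[1, R]` with accuracy `ε₁`:
evaluated at a float approximating `x` with relative error less than the machine precision, it
approximates `arcosh x` with absolute error less than `ε₁`. -/
def IsFloatArcosh (p : ℕ) (R ε₁ : ℝ) (A : ℝ → ℝ) : Prop :=
  ∀ x f : ℝ, 1 ≤ x → x ≤ R → IsFloat p f → 1 ≤ f → f ≤ R →
    |f - x| < machineEps p * |x| → |Real.arcosh x - A f| < ε₁

end

/-!
Write `ε` for `machineEps p`. The routines are exact until their last step. Over floats,
`FastTwoSum` and one fused multiply-add give the rounding errors of `+` and `*` exactly, so a sum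
or a product of expansions is the exact sum of an explicit list of floats. `distill` turns such a
list into a nonoverlapping one (Shewchuk's grow-expansion), and absorbing its terms from the top
down until an addition is inexact yields a float with relative error about `ε` (`roughSum_error`):
at that moment the sum exceeds the grid of its operands by `p` bits, and everything that remains
lies below this grid. Adding the same approximation of the exact residual gives `lead`, with
relative error at most `(7 / 10) ε` (`lead_error`). Iterating on residuals produces a
ulp-nonoverlapping expansion with relative error at most `((7 / 10) ε) ^ t` (`isFPE_term`,
`sum_term_error`). A quotient is the sum of the digits of a long division, each of which at least
halves the remainder.

For the distance, put `A = 1 - ‖x‖ ^ 2`, `B = 1 - ‖y‖ ^ 2` and `w = ‖x - y‖ / √(A B)`, so that the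
argument of `arcosh` is `z = 1 + 2 w ^ 2`. The distance `ε ^ (t - 1)` from the boundary keeps the
relative errors of the computed `A` and `B` near `3 ε / 2` (`one_sub_sqNorm_bounds`) and the
absolute error of `w` at most `ε` (`abs_norm_pointOf_sub_le`). Hence the leading term `f` of the
computed argument satisfies `f ≤ (1 + 8 ε) z ≤ 2 z` and `z ≤ (1 + 28 ε) f`
(`leading_term_bounds`). Moreover `1 ≤ f`, since `lead` does not fall below `1` when the exact sum
is at least `1` (`one_le_lead`). By `cosh (α + δ) ≥ cosh α cosh δ`, such a relative error changes
`arcosh` by at most `(15 / 2) √ε`. On the other hand any floating-point inverse hyperbolic cosine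
has accuracy `ε₁ > √ε / 2`, because at the float `1` it approximates both `arcosh 1` and `arcosh
(1 + ε)`. So the total error is below `ε₁ + 15 ε₁`.
-/

/-! ### Grids of multiples of a power of two -/

/-- `x` is an integer multiple of `2 ^ s`. -/
def OnGrid (s : ℤ) (x : ℝ) : Prop := ∃ m : ℤ, x = (m : ℝ) * (2 : ℝ) ^ s

namespace OnGrid

variable {s k : ℤ} {x y : ℝ}

theorem zero (s : ℤ) : OnGrid s 0 := ⟨0, by simp⟩

theorem add (hx : OnGrid s x) (hy : OnGrid s y) : OnGrid s (x + y) := by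
  obtain ⟨m, rfl⟩ := hx
  obtain ⟨n, rfl⟩ := hy
  exact ⟨m + n, by push_cast; ring⟩

theorem neg (hx : OnGrid s x) : OnGrid s (-x) := by
  obtain ⟨m, rfl⟩ := hx
  exact ⟨-m, by push_cast; ring⟩

theorem sub (hx : OnGrid s x) (hy : OnGrid s y) : OnGrid s (x - y) := by
  rw [sub_eq_add_neg]
  exact hx.add hy.neg

theorem mul (hx : OnGrid s x) (hy : OnGrid k y) : OnGrid (s + k) (x * y) := by
  obtain ⟨m, rfl⟩ := hx
  obtain ⟨n, rfl⟩ := hy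
  exact ⟨m * n, by rw [zpow_add₀ two_ne_zero]; push_cast; ring⟩

theorem mono (h : s ≤ k) (hx : OnGrid k x) : OnGrid s x := by
  obtain ⟨m, rfl⟩ := hx
  refine ⟨m * 2 ^ (k - s).toNat, ?_⟩
  push_cast
  rw [← zpow_natCast, Int.toNat_of_nonneg (by omega), mul_assoc, ← zpow_add₀ two_ne_zero]
  congr 2
  omega

theorem le_abs (hx : OnGrid s x) (h0 : x ≠ 0) : (2 : ℝ) ^ s ≤ |x| := by
  obtain ⟨m, rfl⟩ := hx
  have hm : m ≠ 0 := by rintro rfl; simp at h0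
  have h1 : (1 : ℝ) ≤ |(m : ℝ)| := by exact_mod_cast Int.one_le_abs hm
  have hs : (0 : ℝ) < 2 ^ s := by positivity
  rw [abs_mul, abs_of_pos hs]
  nlinarith

/-- Below the grid point `2 ^ k` there is room for one more grid step. -/
theorem abs_add_le (hx : OnGrid s x) (hsk : s ≤ k) (h : |x| < 2 ^ k) :
    |x| + 2 ^ s ≤ (2 : ℝ) ^ k := by
  obtain ⟨m, rfl⟩ := hx
  have hs : (0 : ℝ) < 2 ^ s := by positivity
  obtain ⟨n, rfl⟩ : ∃ n : ℕ, k = s + n := ⟨(k - s).toNat, by omega⟩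
  rw [abs_mul, abs_of_pos hs, zpow_add₀ two_ne_zero, zpow_natCast] at *
  have h1 : |(m : ℝ)| < 2 ^ n := by nlinarith
  have h2 : |m| + 1 ≤ 2 ^ n := by
    have : |m| < 2 ^ n := by exact_mod_cast h1
    omega
  have h3 : |(m : ℝ)| + 1 ≤ 2 ^ n := by exact_mod_cast h2
  nlinarith

end OnGrid

theorem exists_zpow_le_abs_lt (c : ℤ) {x : ℝ} (hx : x ≠ 0) :
    ∃ k : ℤ, (2 : ℝ) ^ (c - 1 + k) ≤ |x| ∧ |x| < 2 ^ (c + k) := by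
  obtain ⟨n, h1, h2⟩ := exists_mem_Ico_zpow (abs_pos.2 hx) (one_lt_two (α := ℝ))
  refine ⟨n + 1 - c, ?_, ?_⟩
  · rwa [show c - 1 + (n + 1 - c) = n by ring]
  · rwa [show c + (n + 1 - c) = n + 1 by ring]

/-! ### Floats and rounding to nearest -/

theorem machineEps_pos (p : ℕ) : 0 < machineEps p := by unfold machineEps; positivity

theorem machineEps_le {p : ℕ} (hp : 4 ≤ p) : machineEps p ≤ 1 / 8 := by
  calc machineEps p ≤ 2 ^ (-3 : ℤ) := zpow_le_zpow_right₀ one_le_two (by omega)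
    _ = 1 / 8 := by norm_num

theorem machineEps_le_one {p : ℕ} (hp : 1 ≤ p) : machineEps p ≤ 1 :=
  zpow_le_one_of_nonpos₀ one_le_two (by omega)

theorem zpow_le_ulp {p : ℕ} {x : ℝ} {k : ℤ} (h : (2 : ℝ) ^ ((p : ℤ) - 1 + k) ≤ |x|) :
    (2 : ℝ) ^ k ≤ ulp p x := by
  have hpos : (0 : ℝ) < |x| := lt_of_lt_of_le (by positivity) h
  rw [ulp, if_neg (abs_pos.1 hpos)]
  have := (Int.zpow_le_iff_le_log (b := 2) one_lt_two hpos).1 (by simpa using h)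
  exact zpow_le_zpow_right₀ one_le_two (by omega)

theorem abs_int_mul_zpow_le {p : ℕ} {m : ℤ} (e : ℤ) (hm : |m| < 2 ^ p) :
    |(m : ℝ) * 2 ^ e| ≤ 2 ^ ((p : ℤ) + e) := by
  have he : (0 : ℝ) < 2 ^ e := by positivity
  have h1 : |(m : ℝ)| < 2 ^ p := by exact_mod_cast hm
  rw [zpow_add₀ two_ne_zero, zpow_natCast, abs_mul, abs_of_pos he]
  nlinarith

namespace IsFloat

variable {p : ℕ} {x y : ℝ}

theorem zero (p : ℕ) : IsFloat p 0 := ⟨0, 0, by simp, by simp⟩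

theorem neg (hx : IsFloat p x) : IsFloat p (-x) := by
  obtain ⟨m, e, h, rfl⟩ := hx
  exact ⟨-m, e, by rwa [abs_neg], by push_cast; ring⟩

theorem of_onGrid (hp : 1 ≤ p) {s : ℤ} (hx : OnGrid s x) (h : |x| ≤ 2 ^ (p + s)) :
    IsFloat p x := by
  obtain ⟨m, rfl⟩ := hx
  have hs : (0 : ℝ) < 2 ^ s := by positivity
  have h1 : |(m : ℝ)| ≤ 2 ^ p := by
    rw [abs_mul, abs_of_pos hs, zpow_add₀ two_ne_zero, zpow_natCast] at h
    nlinarith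
  have h2 : |m| ≤ 2 ^ p := by exact_mod_cast h1
  have h3 : (1 : ℤ) < 2 ^ p := one_lt_pow₀ (by norm_num) (by omega)
  rcases h2.lt_or_eq with h2 | h2
  · exact ⟨m, s, h2, rfl⟩
  · rcases (abs_eq (by positivity)).1 h2 with h2 | h2
    · exact ⟨1, p + s, by simpa, by rw [h2, zpow_add₀ two_ne_zero]; simp⟩
    · exact ⟨-1, p + s, by simpa, by rw [h2, zpow_add₀ two_ne_zero]; simp⟩

theorem zpow (hp : 1 ≤ p) (k : ℤ) : IsFloat p ((2 : ℝ) ^ k) :=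
  ⟨1, k, by simpa using one_lt_pow₀ (one_lt_two (α := ℤ)) (by omega : p ≠ 0), by simp⟩

theorem onGrid (hx : IsFloat p x) {k : ℤ} (h : (2 : ℝ) ^ ((p : ℤ) - 1 + k) ≤ |x|) :
    OnGrid k x := by
  obtain ⟨m, e, hm, rfl⟩ := hx
  refine OnGrid.mono ?_ ⟨m, rfl⟩
  have he : (0 : ℝ) < 2 ^ e := by positivity
  have h1 : |(m : ℝ)| < 2 ^ p := by exact_mod_cast hm
  rw [abs_mul, abs_of_pos he] at h
  have h2 : (2 : ℝ) ^ ((p : ℤ) - 1 + k) < 2 ^ ((p : ℤ) + e) := by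
    rw [zpow_add₀ two_ne_zero (p : ℤ) e, zpow_natCast]
    nlinarith
  have := (zpow_lt_zpow_iff_right₀ (one_lt_two (α := ℝ))).1 h2
  omega

/-- **Sterbenz's lemma**: the difference of two nearby floats is a float. -/
theorem sub_of_le (hp : 1 ≤ p) (hx : IsFloat p x) (hy : IsFloat p y)
    (h1 : |x - y| ≤ |x|) (h2 : |x - y| ≤ |y|) : IsFloat p (x - y) := by
  obtain ⟨m, e, hm, rfl⟩ := hx
  obtain ⟨n, f, hn, rfl⟩ := hy
  rcases le_total e f with hef | hef
  · exact of_onGrid hp (OnGrid.sub ⟨m, rfl⟩ (OnGrid.mono hef ⟨n, rfl⟩))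
      (h1.trans (abs_int_mul_zpow_le e hm))
  · exact of_onGrid hp (OnGrid.sub (OnGrid.mono hef ⟨m, rfl⟩) ⟨n, rfl⟩)
      (h2.trans (abs_int_mul_zpow_le f hn))

end IsFloat

namespace IsRoundToNearest

variable {p : ℕ} {fl : ℝ → ℝ} {x y : ℝ}

theorem eq_self (hfl : IsRoundToNearest p fl) (hx : IsFloat p x) : fl x = x := by
  have := (hfl x).2 x hx
  rw [sub_self, abs_zero] at this
  linarith [abs_nonpos_iff.1 this]

theorem le_fl (hfl : IsRoundToNearest p fl) (hy : IsFloat p y) (h : y ≤ x) : y ≤ fl x := by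
  by_contra! hlt
  have := (hfl x).2 y hy
  rw [abs_of_nonneg (by linarith), abs_of_nonneg (by linarith)] at this
  linarith

theorem fl_le (hfl : IsRoundToNearest p fl) (hy : IsFloat p y) (h : x ≤ y) : fl x ≤ y := by
  by_contra! hlt
  have := (hfl x).2 y hy
  rw [abs_of_nonpos (by linarith), abs_of_nonpos (by linarith)] at this
  linarith

theorem le_abs_fl (hfl : IsRoundToNearest p fl) (hy : IsFloat p y) (h : y ≤ |x|) :
    y ≤ |fl x| := by
  rcases abs_cases x with ⟨hx, _⟩ | ⟨hx, _⟩ <;> rw [hx] at h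
  · exact (hfl.le_fl hy h).trans (le_abs_self _)
  · have := hfl.fl_le hy.neg (by linarith : x ≤ -y)
    exact (by linarith : y ≤ -fl x).trans (neg_le_abs _)

/-- Rounding never refines a grid. -/
theorem onGrid_fl (hfl : IsRoundToNearest p fl) (hp : 1 ≤ p) {s : ℤ} (hx : OnGrid s x) :
    OnGrid s (fl x) := by
  rcases le_total |x| (2 ^ ((p : ℤ) + s)) with h | h
  · rwa [hfl.eq_self (IsFloat.of_onGrid hp hx h)]
  · have := hfl.le_abs_fl (IsFloat.zpow hp _) h
    refine OnGrid.mono (by omega : s ≤ s + 1) ((hfl x).1.onGrid (this.trans' (le_of_eq ?_)))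
    congr 1; ring

theorem abs_sub_fl_le (hfl : IsRoundToNearest p fl) (hp : 1 ≤ p) {k : ℤ}
    (h : |x| ≤ 2 ^ ((p : ℤ) + k)) : |x - fl x| ≤ 2 ^ (k - 1) := by
  have hk : (0 : ℝ) < 2 ^ k := by positivity
  have h2 : (2 : ℝ) ^ (k - 1) = 2 ^ k / 2 := by
    rw [zpow_sub₀ two_ne_zero, zpow_one]
  have hr := abs_sub_round (x / 2 ^ k)
  have hle : |(round (x / 2 ^ k) : ℝ)| ≤ 2 ^ p := by
    rw [zpow_add₀ two_ne_zero, zpow_natCast, abs_le] at h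
    have h3 : x / 2 ^ k ≤ ((2 ^ p : ℤ) : ℝ) := by
      rw [div_le_iff₀ hk]; push_cast; exact h.2
    have h4 : ((-2 ^ p : ℤ) : ℝ) ≤ x / 2 ^ k := by
      rw [le_div_iff₀ hk]; push_cast; linarith [h.1]
    have h5 : round (x / 2 ^ k) ≤ 2 ^ p := by
      rw [round_eq, ← Int.lt_add_one_iff, Int.floor_lt]
      push_cast at h3 ⊢
      linarith
    have h6 : -2 ^ p ≤ round (x / 2 ^ k) := by
      rw [round_eq, Int.le_floor]
      push_cast at h4 ⊢
      linarith
    rw [abs_le]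
    constructor <;> [exact_mod_cast h6; exact_mod_cast h5]
  have hf : IsFloat p ((round (x / 2 ^ k) : ℝ) * 2 ^ k) := by
    refine IsFloat.of_onGrid hp ⟨_, rfl⟩ ?_
    rw [zpow_add₀ two_ne_zero, zpow_natCast, abs_mul, abs_of_pos hk]
    nlinarith
  refine ((hfl x).2 _ hf).trans ?_
  have : x - (round (x / 2 ^ k) : ℝ) * 2 ^ k = (x / 2 ^ k - round (x / 2 ^ k)) * 2 ^ k := by
    field_simp
  rw [this, abs_mul, abs_of_pos hk, h2]
  nlinarith

/-- The standard model of rounding: the relative error is at most half the machine precision. -/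
theorem abs_sub_fl_le_mul (hfl : IsRoundToNearest p fl) (hp : 1 ≤ p) (x : ℝ) :
    |x - fl x| ≤ machineEps p / 2 * |x| := by
  rcases eq_or_ne x 0 with rfl | hx
  · simp [hfl.eq_self (IsFloat.zero p)]
  · obtain ⟨k, h1, h2⟩ := exists_zpow_le_abs_lt p hx
    refine (hfl.abs_sub_fl_le hp h2.le).trans ?_
    have h3 : (2 : ℝ) ^ (k - 1) = machineEps p / 2 * 2 ^ ((p : ℤ) - 1 + k) := by
      have : (2 : ℝ) ^ (k - 1) = 2 ^ (1 - (p : ℤ)) * 2 ^ (-1 : ℤ) * 2 ^ ((p : ℤ) - 1 + k) := by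
        rw [← zpow_add₀ two_ne_zero, ← zpow_add₀ two_ne_zero]
        congr 1; ring
      rw [this, machineEps]
      rw [zpow_neg_one]
      ring
    rw [h3]
    have := machineEps_pos p
    gcongr

/-- The rounding error of an inexact operation lies strictly below a grid that contains the
rounded result. -/
theorem exists_onGrid_of_ne (hfl : IsRoundToNearest p fl) (hp : 1 ≤ p) (hx : x - fl x ≠ 0) :
    ∃ s, |x - fl x| < 2 ^ s ∧ OnGrid s (fl x) := by
  have hx0 : x ≠ 0 := by
    rintro rfl
    simp [hfl.eq_self (IsFloat.zero p)] at hx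
  obtain ⟨k, h1, h2⟩ := exists_zpow_le_abs_lt p hx0
  refine ⟨k, (hfl.abs_sub_fl_le hp h2.le).trans_lt ?_, ?_⟩
  · exact zpow_lt_zpow_right₀ one_lt_two (by omega)
  · exact (hfl x).1.onGrid (hfl.le_abs_fl (IsFloat.zpow hp _) h1)

theorem abs_add_sub_fl_le_right (hfl : IsRoundToNearest p fl) (hx : IsFloat p x) :
    |x + y - fl (x + y)| ≤ |y| := by
  simpa using (hfl (x + y)).2 x hx

theorem abs_add_sub_fl_le_left (hfl : IsRoundToNearest p fl) (hy : IsFloat p y) :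
    |x + y - fl (x + y)| ≤ |x| := by
  simpa using (hfl (x + y)).2 y hy

theorem isFloat_add_sub_fl (hfl : IsRoundToNearest p fl) (hp : 1 ≤ p) (hx : IsFloat p x)
    (hy : IsFloat p y) : IsFloat p (x + y - fl (x + y)) := by
  have h1 := hfl.abs_add_sub_fl_le_left (x := x) hy
  have h2 := hfl.abs_add_sub_fl_le_right (y := y) hx
  obtain ⟨m, e, hm, hxe⟩ := hx
  obtain ⟨n, f, hn, hye⟩ := hy
  have hgrid : ∀ {s}, s ≤ e → s ≤ f → OnGrid s (x + y - fl (x + y)) := by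
    intro s hse hsf
    have : OnGrid s (x + y) := (OnGrid.mono hse ⟨m, hxe⟩).add (OnGrid.mono hsf ⟨n, hye⟩)
    exact this.sub (hfl.onGrid_fl hp this)
  rcases le_total e f with hef | hef
  · exact IsFloat.of_onGrid hp (hgrid le_rfl hef) (h1.trans (hxe ▸ abs_int_mul_zpow_le e hm))
  · exact IsFloat.of_onGrid hp (hgrid hef le_rfl) (h2.trans (hye ▸ abs_int_mul_zpow_le f hn))

theorem isFloat_mul_sub_fl (hfl : IsRoundToNearest p fl) (hp : 1 ≤ p) (hx : IsFloat p x)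
    (hy : IsFloat p y) : IsFloat p (x * y - fl (x * y)) := by
  obtain ⟨m, e, hm, rfl⟩ := hx
  obtain ⟨n, f, hn, rfl⟩ := hy
  have hg : OnGrid (e + f) ((m : ℝ) * 2 ^ e * (n * 2 ^ f)) := OnGrid.mul ⟨m, rfl⟩ ⟨n, rfl⟩
  refine IsFloat.of_onGrid hp (hg.sub (hfl.onGrid_fl hp hg)) ?_
  have h1 : |(m : ℝ)| < 2 ^ p := by exact_mod_cast hm
  have h2 : |(n : ℝ)| < 2 ^ p := by exact_mod_cast hn
  have : |(m : ℝ) * 2 ^ e * (n * 2 ^ f)| ≤ 2 ^ ((p : ℤ) + (p + (e + f))) := by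
    rw [abs_mul, abs_mul, abs_mul, abs_of_pos (by positivity : (0 : ℝ) < 2 ^ e),
      abs_of_pos (by positivity : (0 : ℝ) < 2 ^ f), zpow_add₀ two_ne_zero, zpow_add₀ two_ne_zero,
      zpow_add₀ two_ne_zero, zpow_natCast]
    calc |(m : ℝ)| * 2 ^ e * (|(n : ℝ)| * 2 ^ f) = |(m : ℝ)| * |(n : ℝ)| * (2 ^ e * 2 ^ f) := by
          ring
      _ ≤ 2 ^ p * 2 ^ p * (2 ^ e * 2 ^ f) := by gcongr
      _ = _ := by ring
  refine (hfl.abs_sub_fl_le hp this).trans ?_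
  exact zpow_le_zpow_right₀ one_le_two (by omega)

/-- In `FastTwoSum`, for `|y| ≤ |x|`, the difference `fl (x + y) - x` is exact. -/
theorem isFloat_fl_add_sub (hfl : IsRoundToNearest p fl) (hp : 1 ≤ p) (hx : IsFloat p x)
    (hy : IsFloat p y) (hyx : |y| ≤ |x|) : IsFloat p (fl (x + y) - x) := by
  -- either `x + y` is itself a difference of nearby floats, or `fl (x + y)` is near `x`
  by_cases hclose : |x + y| ≤ |y|
  · have : IsFloat p (x + y) := by
      have := hx.sub_of_le hp hy.neg (by simpa using hclose.trans hyx) (by simpa using hclose)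
      simpa using this
    rw [hfl.eq_self this]
    simpa using hy
  · have half : ∀ {z : ℝ}, IsFloat p z → IsFloat p (z / 2) := by
      rintro z ⟨m, e, hm, rfl⟩
      exact ⟨m, e - 1, hm, by rw [zpow_sub₀ two_ne_zero, zpow_one]; ring⟩
    have double : ∀ {z : ℝ}, IsFloat p z → IsFloat p (2 * z) := by
      rintro z ⟨m, e, hm, rfl⟩
      exact ⟨m, e + 1, hm, by rw [zpow_add₀ two_ne_zero, zpow_one]; ring⟩
    push Not at hclose
    rcases le_total 0 x with h0 | h0
    · have h1 : x / 2 ≤ fl (x + y) := hfl.le_fl (half hx) (by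
        rw [abs_of_nonneg h0] at hyx
        grind [abs_le])
      have h2 : fl (x + y) ≤ 2 * x := hfl.fl_le (double hx) (by
        rw [abs_of_nonneg h0] at hyx; linarith [le_abs_self y])
      apply (hfl _).1.sub_of_le hp hx <;> grind [abs_le]
    · have h1 : fl (x + y) ≤ x / 2 := hfl.fl_le (half hx) (by
        grind [abs_le])
      have h2 : 2 * x ≤ fl (x + y) := hfl.le_fl (double hx) (by
        rw [abs_of_nonpos h0] at hyx; linarith [neg_le_abs y])
      apply (hfl _).1.sub_of_le hp hx <;> grind [abs_le]

/-- A number that misses `1` by at most `3/10` of the gap between `1` and the float below it rounds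
to at least `1`. -/
theorem one_le_fl (hfl : IsRoundToNearest p fl) (hp : 1 ≤ p)
    (hx : 1 - 3 / 10 * (machineEps p / 2) ≤ x) : 1 ≤ fl x := by
  have hu := machineEps_pos p
  have one : IsFloat p 1 := by simpa using IsFloat.zpow hp 0
  rcases le_total 1 x with h | h
  · exact hfl.le_fl one h
  · by_contra! hlt
    have hgap : fl x ≤ 1 - machineEps p / 2 := by
      rcases le_total (1 / 2) (fl x) with h2 | h2
      · have hg : OnGrid (-p) (fl x) := (hfl x).1.onGrid (by
          rw [show (p : ℤ) - 1 + -p = -1 by ring, abs_of_nonneg (by linarith)]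
          norm_num at h2 ⊢; exact h2)
        have := OnGrid.abs_add_le hg (by omega : -(p : ℤ) ≤ 0) (by
          rw [abs_of_nonneg (by linarith)]; simpa using hlt)
        rw [abs_of_nonneg (by linarith), zpow_zero] at this
        have h3 : machineEps p / 2 = 2 ^ (-(p : ℤ)) := by
          rw [machineEps, sub_eq_add_neg, zpow_add₀ two_ne_zero]; norm_num
        linarith
      · have := machineEps_le_one hp
        linarith
    have := (hfl x).2 1 one
    rw [abs_of_nonneg (by linarith), abs_of_nonpos (by linarith)] at this
    linarith

end IsRoundToNearest

/-! ### Exact building blocks for floating-point computations -/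

namespace FloatExpr

variable {ι : Type} {p : ℕ} {fl : ℝ → ℝ} {v : ι → ℝ}

/-- The constant `0`. -/
def zero : FloatExpr ι := const 0 0

/-- Negation, which is exact. -/
def neg (a : FloatExpr ι) : FloatExpr ι := sub zero a

/-- Absolute value, which is exact. -/
def abs (a : FloatExpr ι) : FloatExpr ι := ifLE zero a a (neg a)

/-- The rounding error of `a + b`, computed by Dekker's `FastTwoSum` with the larger operand
first. -/
def addErr (a b : FloatExpr ι) : FloatExpr ι :=
  ifLE (abs b) (abs a) (sub b (sub (add a b) a)) (sub a (sub (add b a) b))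

/-- The rounding error of `a * b`, computed by one fused multiply-add. -/
def mulErr (a b : FloatExpr ι) : FloatExpr ι := fma a b (neg (mul a b))

theorem isFloat_eval (hfl : IsRoundToNearest p fl) (hv : ∀ i, IsFloat p (v i))
    (a : FloatExpr ι) : IsFloat p (a.eval fl v) := by
  induction a with
  | var i => exact hv i
  | ifLE a b c d _ _ hc hd => unfold eval; split_ifs <;> assumption
  | _ => exact (hfl _).1

theorem eval_zero (hfl : IsRoundToNearest p fl) : (zero : FloatExpr ι).eval fl v = 0 := by
  simp [zero, eval, hfl.eq_self (IsFloat.zero p)]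

theorem eval_neg (hfl : IsRoundToNearest p fl) (hv : ∀ i, IsFloat p (v i)) (a : FloatExpr ι) :
    (neg a).eval fl v = -a.eval fl v := by
  simp [neg, eval, eval_zero hfl, hfl.eq_self (isFloat_eval hfl hv a).neg]

theorem eval_abs (hfl : IsRoundToNearest p fl) (hv : ∀ i, IsFloat p (v i)) (a : FloatExpr ι) :
    (abs a).eval fl v = |a.eval fl v| := by
  simp only [abs, eval, eval_zero hfl, eval_neg hfl hv]
  split_ifs with h
  · rw [abs_of_nonneg h]
  · rw [abs_of_neg (not_le.1 h)]

theorem eval_addErr (hfl : IsRoundToNearest p fl) (hp : 1 ≤ p) (hv : ∀ i, IsFloat p (v i))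
    (a b : FloatExpr ι) :
    (addErr a b).eval fl v
      = a.eval fl v + b.eval fl v - fl (a.eval fl v + b.eval fl v) := by
  have fast : ∀ {x y : ℝ}, IsFloat p x → IsFloat p y → |y| ≤ |x| →
      fl (y - fl (fl (x + y) - x)) = x + y - fl (x + y) := by
    intro x y hx hy hyx
    rw [hfl.eq_self (hfl.isFloat_fl_add_sub hp hx hy hyx)]
    have h := hfl.eq_self (hfl.isFloat_add_sub_fl hp hx hy)
    rwa [show y - (fl (x + y) - x) = x + y - fl (x + y) by ring]
  have ha := isFloat_eval hfl hv a
  have hb := isFloat_eval hfl hv b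
  simp only [addErr, eval, eval_abs hfl hv]
  split_ifs with h
  · exact fast ha hb h
  · rw [fast hb ha (not_le.1 h).le, add_comm]

theorem eval_mulErr (hfl : IsRoundToNearest p fl) (hp : 1 ≤ p) (hv : ∀ i, IsFloat p (v i))
    (a b : FloatExpr ι) :
    (mulErr a b).eval fl v
      = a.eval fl v * b.eval fl v - fl (a.eval fl v * b.eval fl v) := by
  have h := hfl.eq_self (hfl.isFloat_mul_sub_fl hp (isFloat_eval hfl hv a) (isFloat_eval hfl hv b))
  simpa only [mulErr, eval, eval_neg hfl hv, ← sub_eq_add_neg] using h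

/-! ### Exact sums of lists of floats -/

/-- The exact, unrounded sum of the values of a list of computations. -/
noncomputable def total (fl : ℝ → ℝ) (v : ι → ℝ) (l : List (FloatExpr ι)) : ℝ :=
  (l.map (eval fl v)).sum

@[simp] theorem total_nil : total fl v [] = 0 := rfl

@[simp] theorem total_cons (a : FloatExpr ι) (l : List (FloatExpr ι)) :
    total fl v (a :: l) = a.eval fl v + total fl v l := by
  simp [total]

@[simp] theorem total_append (l l' : List (FloatExpr ι)) :
    total fl v (l ++ l') = total fl v l + total fl v l' := by
  simp [total]

theorem total_map_neg (hfl : IsRoundToNearest p fl) (hv : ∀ i, IsFloat p (v i))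
    (l : List (FloatExpr ι)) : total fl v (l.map neg) = -total fl v l := by
  induction l with
  | nil => simp
  | cons a l ih => simp [ih, eval_neg hfl hv]; ring

/-- Every product of a term of `l` with a term of `l'`, as its rounded value and its error. -/
def prodTerms (l l' : List (FloatExpr ι)) : List (FloatExpr ι) :=
  l.flatMap fun a => l'.flatMap fun b => [mul a b, mulErr a b]

theorem total_prodTerms (hfl : IsRoundToNearest p fl) (hp : 1 ≤ p) (hv : ∀ i, IsFloat p (v i))
    (l l' : List (FloatExpr ι)) :
    total fl v (prodTerms l l') = total fl v l * total fl v l' := by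
  have inner : ∀ a : FloatExpr ι, total fl v (l'.flatMap fun b => [mul a b, mulErr a b])
      = a.eval fl v * total fl v l' := by
    intro a
    induction l' with
    | nil => simp
    | cons b l' ih =>
      simp only [List.flatMap_cons, total_append, ih, total_cons, total_nil, eval,
        eval_mulErr hfl hp hv]
      ring
  unfold prodTerms
  induction l with
  | nil => simp
  | cons a l ih => simp only [List.flatMap_cons, total_append, ih, total_cons, inner]; ring

/-! ### Distillation into a nonoverlapping list -/

/-- Shewchuk's `Grow-Expansion`: add `b` to a list sorted from the lowest term up, keeping every
rounding error. -/
def grow (b : FloatExpr ι) : List (FloatExpr ι) → List (FloatExpr ι)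
  | [] => [b]
  | e :: l => addErr b e :: grow (add b e) l

/-- A list with the same exact sum and nonoverlapping terms, lowest first. -/
def distill (l : List (FloatExpr ι)) : List (FloatExpr ι) := l.foldr grow []

/-- Each term of the list is zero or lies strictly below a grid that contains all later terms. -/
def Nonoverlapping (fl : ℝ → ℝ) (v : ι → ℝ) : List (FloatExpr ι) → Prop
  | [] => True
  | h :: l => (h.eval fl v = 0 ∨
      ∃ s, |h.eval fl v| < 2 ^ s ∧ ∀ a ∈ l, OnGrid s (a.eval fl v)) ∧ Nonoverlapping fl v l

theorem total_grow (hfl : IsRoundToNearest p fl) (hp : 1 ≤ p) (hv : ∀ i, IsFloat p (v i))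
    (b : FloatExpr ι) (l : List (FloatExpr ι)) :
    total fl v (grow b l) = b.eval fl v + total fl v l := by
  induction l generalizing b with
  | nil => simp [grow]
  | cons e l ih =>
    simp only [grow, total_cons, ih, eval_addErr hfl hp hv, eval]
    ring

theorem total_distill (hfl : IsRoundToNearest p fl) (hp : 1 ≤ p) (hv : ∀ i, IsFloat p (v i))
    (l : List (FloatExpr ι)) : total fl v (distill l) = total fl v l := by
  induction l with
  | nil => rfl
  | cons a l ih =>
    rw [total_cons, ← ih]
    exact total_grow hfl hp hv a (distill l)

theorem onGrid_grow (hfl : IsRoundToNearest p fl) (hp : 1 ≤ p) (hv : ∀ i, IsFloat p (v i))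
    {s : ℤ} {b : FloatExpr ι} {l : List (FloatExpr ι)} (hb : OnGrid s (b.eval fl v))
    (hl : ∀ a ∈ l, OnGrid s (a.eval fl v)) : ∀ a ∈ grow b l, OnGrid s (a.eval fl v) := by
  induction l generalizing b with
  | nil => simpa [grow] using hb
  | cons e l ih =>
    have he := hb.add (hl e (by simp))
    have hQ := hfl.onGrid_fl hp he
    intro a ha
    rcases List.mem_cons.1 ha with rfl | ha
    · rw [eval_addErr hfl hp hv]
      exact he.sub hQ
    · exact ih (b := add b e) hQ (fun a ha => hl a (by simp [ha])) a ha

theorem Nonoverlapping.grow (hfl : IsRoundToNearest p fl) (hp : 1 ≤ p)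
    (hv : ∀ i, IsFloat p (v i)) (b : FloatExpr ι) {l : List (FloatExpr ι)}
    (hl : Nonoverlapping fl v l) : Nonoverlapping fl v (grow b l) := by
  induction l generalizing b with
  | nil => exact ⟨Or.inr ⟨_, Int.lt_zpow_succ_log_self (R := ℝ) (b := 2) one_lt_two _,
      by simp⟩, trivial⟩
  | cons e l ih =>
    refine ⟨?_, ih _ hl.2⟩
    rw [eval_addErr hfl hp hv]
    refine or_iff_not_imp_left.2 fun h0 => ?_
    -- the error is at most `|e|`, and less than an ulp of the rounded sum that is carried upward
    have hle := hfl.abs_add_sub_fl_le_right (y := e.eval fl v) (isFloat_eval hfl hv b)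
    have he : e.eval fl v ≠ 0 := fun h => h0 (by simpa [h] using hle)
    obtain ⟨s, hs, hls⟩ := hl.1.resolve_left he
    obtain ⟨s', hs', hQ⟩ := hfl.exists_onGrid_of_ne hp h0
    refine ⟨min s s', ?_, onGrid_grow hfl hp hv (hQ.mono (min_le_right _ _))
      fun a ha => (hls a ha).mono (min_le_left _ _)⟩
    rcases min_choice s s' with h | h <;> rw [h]
    · exact hle.trans_lt hs
    · exact hs'

theorem nonoverlapping_distill (hfl : IsRoundToNearest p fl) (hp : 1 ≤ p)
    (hv : ∀ i, IsFloat p (v i)) (l : List (FloatExpr ι)) :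
    Nonoverlapping fl v (distill l) := by
  induction l with
  | nil => trivial
  | cons a l ih => exact ih.grow hfl hp hv a

theorem Nonoverlapping.tail_of_append {l l' : List (FloatExpr ι)}
    (h : Nonoverlapping fl v (l ++ l')) : Nonoverlapping fl v l' := by
  induction l with
  | nil => exact h
  | cons a l ih => exact ih h.2

/-- An initial segment of a nonoverlapping list has sum zero, or its sum lies strictly below a
grid that contains all later terms. -/
theorem Nonoverlapping.total_low {l l' : List (FloatExpr ι)}
    (h : Nonoverlapping fl v (l ++ l')) : total fl v l = 0 ∨
      ∃ s, |total fl v l| < 2 ^ s ∧ ∀ a ∈ l', OnGrid s (a.eval fl v) := by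
  induction l using List.reverseRecOn generalizing l' with
  | nil => simp
  | append_singleton l a ih =>
    rw [List.append_assoc] at h
    have hlow := ih h
    have ha := h.tail_of_append.1
    simp only [total_append, total_cons, total_nil, add_zero]
    rcases eq_or_ne (a.eval fl v) 0 with h0 | h0
    · rw [h0, add_zero]
      exact hlow.imp_right fun ⟨s, hs, hl⟩ => ⟨s, hs, fun b hb => hl b (by simp_all)⟩
    · obtain ⟨k, hk, hlk⟩ := ha.resolve_left h0
      right
      rcases hlow with hz | ⟨s, hs, hl⟩
      · exact ⟨k, by rwa [hz, zero_add], hlk⟩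
      · have hga := hl a (by simp)
        have hsk : s ≤ k := by
          have := (hga.le_abs h0).trans_lt hk
          exact ((zpow_lt_zpow_iff_right₀ (one_lt_two (α := ℝ))).1 this).le
        refine ⟨k, ?_, hlk⟩
        linarith [abs_add_le (total fl v l) (a.eval fl v), hga.abs_add_le hsk hk]

/-! ### The leading part of a sum of floats -/

/-- Absorb the terms of a list into `q` as long as the addition is exact, and stop after the first
addition that is not. -/
def absorb (q : FloatExpr ι) : List (FloatExpr ι) → FloatExpr ι
  | [] => q
  | h :: l => ifLE (abs (addErr q h)) zero (absorb (add q h) l) (add q h)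

/-- A first approximation of the exact sum: the distilled terms absorbed from the top down. -/
def roughSum (l : List (FloatExpr ι)) : FloatExpr ι := absorb zero (distill l).reverse

/-- An approximation of the exact sum by one float: the rough sum plus the rough sum of the
exact residual. -/
def lead (l : List (FloatExpr ι)) : FloatExpr ι :=
  add (roughSum l) (roughSum (neg (roughSum l) :: l))

/-- When an addition is inexact, its operands lie on a grid that is finer by more than `p` bits
than the sum, and what remains of the list lies below that grid. -/
theorem absorb_error (hfl : IsRoundToNearest p fl) (hp : 1 ≤ p) (hv : ∀ i, IsFloat p (v i))
    (q : FloatExpr ι) (l : List (FloatExpr ι))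
    (h : ∀ hi lo, l = hi ++ lo → total fl v lo = 0 ∨ ∃ s, |total fl v lo| < 2 ^ s ∧
      OnGrid s (q.eval fl v) ∧ ∀ a ∈ hi, OnGrid s (a.eval fl v)) :
    (1 - machineEps p / 2) * |q.eval fl v + total fl v l - (absorb q l).eval fl v|
      ≤ machineEps p * |q.eval fl v + total fl v l| := by
  have hu := machineEps_pos p
  induction l generalizing q with
  | nil => simp [absorb]; positivity
  | cons a l ih =>
    simp only [absorb, eval, eval_abs hfl hv, eval_addErr hfl hp hv, eval_zero hfl, total_cons]
    set x := q.eval fl v + a.eval fl v with hx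
    split_ifs with hex
    · -- the addition is exact
      have hxe : fl x = x := by linarith [abs_nonpos_iff.1 hex]
      have := ih (add q a) (fun hi lo hl => by
        refine (h (a :: hi) lo (by simp [hl])).imp_right ?_
        rintro ⟨s, h1, h2, h3⟩
        refine ⟨s, h1, ?_, fun b hb => h3 b (by simp [hb])⟩
        simp only [eval, ← hx, hxe]
        exact h2.add (h3 a (by simp)))
      simp only [eval, ← hx, hxe] at this
      rwa [← add_assoc]
    · have hne : fl x ≠ x := fun hxe => hex (by rw [hxe]; simp)
      have htail : |total fl v l| ≤ machineEps p / 2 * |x| := by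
        rcases h [a] l rfl with h0 | ⟨s, h1, h2, h3⟩
        · rw [h0, abs_zero]; positivity
        · have hgx := h2.add (h3 a (by simp))
          have hbig : (2 : ℝ) ^ ((p : ℤ) + s) < |x| := by
            by_contra! hle
            exact hne (hfl.eq_self (IsFloat.of_onGrid hp hgx hle))
          have h3 : machineEps p / 2 * 2 ^ ((p : ℤ) + s) = 2 ^ s := by
            rw [machineEps, zpow_add₀ two_ne_zero, zpow_sub₀ two_ne_zero]
            field_simp
          have := mul_le_mul_of_nonneg_left hbig.le (by positivity : 0 ≤ machineEps p / 2)
          linarith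
      have hround := hfl.abs_sub_fl_le_mul hp x
      have hu1 := machineEps_le_one hp
      rw [← add_assoc, ← hx]
      have h1 : |x + total fl v l - fl x| ≤ machineEps p * |x| := by
        rw [abs_le] at *
        constructor <;> linarith
      have h2 : (1 - machineEps p / 2) * |x| ≤ |x + total fl v l| := by
        have := abs_sub_abs_le_abs_sub x (-total fl v l)
        rw [abs_neg, sub_neg_eq_add] at this
        linarith
      nlinarith

theorem roughSum_error (hfl : IsRoundToNearest p fl) (hp : 1 ≤ p) (hv : ∀ i, IsFloat p (v i))
    (l : List (FloatExpr ι)) :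
    (1 - machineEps p / 2) * |total fl v l - (roughSum l).eval fl v|
      ≤ machineEps p * |total fl v l| := by
  have hrev : total fl v (distill l).reverse = total fl v l := by
    rw [← total_distill hfl hp hv l]
    simp [total]
  have := absorb_error hfl hp hv zero (distill l).reverse (fun hi lo hl => by
    have hd := nonoverlapping_distill hfl hp hv l
    rw [List.reverse_eq_iff.1 hl, List.reverse_append] at hd
    have ht : total fl v lo.reverse = total fl v lo := by simp [total]
    rw [← ht]
    refine hd.total_low.imp_right ?_
    rintro ⟨s, h1, h2⟩
    refine ⟨s, h1, ?_, fun a ha => h2 a (by simpa using ha)⟩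
    rw [eval_zero hfl]
    exact OnGrid.zero s)
  rwa [eval_zero hfl, zero_add, hrev] at this

/-- Before its last rounding, the leading float is already accurate to a fraction of an ulp. -/
theorem lead_unrounded_error (hfl : IsRoundToNearest p fl) (hp : 4 ≤ p)
    (hv : ∀ i, IsFloat p (v i)) (l : List (FloatExpr ι)) :
    ∃ y, (lead l).eval fl v = fl y ∧
      |total fl v l - y| ≤ 3 / 10 * (machineEps p / 2) * |total fl v l| := by
  refine ⟨_, rfl, ?_⟩
  have h1 := roughSum_error hfl (by omega) hv l
  have h2 := roughSum_error hfl (by omega) hv (neg (roughSum l) :: l)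
  rw [total_cons, eval_neg hfl hv, neg_add_eq_sub] at h2
  have hε := machineEps_pos p
  have := machineEps_le hp
  generalize machineEps p = ε at *
  generalize (roughSum l).eval fl v = s at *
  generalize (roughSum (neg (roughSum l) :: l)).eval fl v = s' at *
  generalize total fl v l = S at *
  have h3 : |S - s| ≤ 16 / 15 * ε * |S| := by nlinarith [abs_nonneg (S - s), abs_nonneg S]
  have h4 : |S - s - s'| ≤ 16 / 15 * ε * |S - s| := by
    nlinarith [abs_nonneg (S - s - s'), abs_nonneg (S - s)]
  calc |S - (s + s')| = |S - s - s'| := by rw [sub_sub]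
    _ ≤ 16 / 15 * ε * (16 / 15 * ε * |S|) := h4.trans (by gcongr)
    _ = 256 / 225 * ε * (ε * |S|) := by ring
    _ ≤ 256 / 225 * (1 / 8) * (ε * |S|) := by gcongr
    _ ≤ 3 / 10 * (ε / 2) * |S| := by nlinarith [mul_nonneg hε.le (abs_nonneg S)]

theorem lead_error (hfl : IsRoundToNearest p fl) (hp : 4 ≤ p) (hv : ∀ i, IsFloat p (v i))
    (l : List (FloatExpr ι)) :
    |total fl v l - (lead l).eval fl v| ≤ 7 / 10 * machineEps p * |total fl v l| := by
  obtain ⟨y, hy, h⟩ := lead_unrounded_error hfl hp hv l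
  have hr := hfl.abs_sub_fl_le_mul (by omega) y
  rw [hy]
  have := machineEps_pos p
  have := machineEps_le hp
  generalize machineEps p = ε at *
  generalize total fl v l = S at *
  have h1 := abs_sub_abs_le_abs_sub y S
  rw [abs_sub_comm y S] at h1
  have h2 := abs_sub_le S y (fl y)
  nlinarith [mul_nonneg (by linarith : 0 ≤ ε) (abs_nonneg S), abs_nonneg y, abs_nonneg S]

theorem one_le_lead (hfl : IsRoundToNearest p fl) (hp : 4 ≤ p) (hv : ∀ i, IsFloat p (v i))
    {l : List (FloatExpr ι)} (hl : 1 ≤ total fl v l) : 1 ≤ (lead l).eval fl v := by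
  obtain ⟨y, hy, h⟩ := lead_unrounded_error hfl hp hv l
  rw [hy]
  refine hfl.one_le_fl (by omega) ?_
  rw [abs_of_pos (a := total fl v l) (by linarith)] at h
  have := machineEps_pos p
  have := machineEps_le hp
  nlinarith [(abs_le.1 h).2]

/-- The leading float of the residual is at most one ulp of the leading float. -/
theorem abs_lead_residual_le (hfl : IsRoundToNearest p fl) (hp : 4 ≤ p)
    (hv : ∀ i, IsFloat p (v i)) (l : List (FloatExpr ι)) :
    |(lead (neg (lead l) :: l)).eval fl v| ≤ ulp p ((lead l).eval fl v) := by
  have h' := lead_error hfl hp hv (neg (lead l) :: l)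
  rw [total_cons, eval_neg hfl hv, neg_add_eq_sub] at h'
  have hlead := lead_error hfl hp hv l
  obtain ⟨y, hy, h⟩ := lead_unrounded_error hfl hp hv l
  rw [hy] at h' hlead ⊢
  generalize (lead (neg (lead l) :: l)).eval fl v = s' at *
  generalize total fl v l = S at *
  have hε := machineEps_pos p
  have hε8 := machineEps_le hp
  rcases eq_or_ne y 0 with rfl | hy0
  · have hfl0 : fl 0 = 0 := hfl.eq_self (IsFloat.zero p)
    rw [sub_zero] at h
    have hS : S = 0 := by
      rw [← abs_nonpos_iff]; nlinarith [abs_nonneg S]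
    subst hS
    simpa [hfl0, ulp] using h'
  · obtain ⟨k, hk1, hk2⟩ := exists_zpow_le_abs_lt p hy0
    have hround := hfl.abs_sub_fl_le (by omega) hk2.le
    have hulp := zpow_le_ulp (hfl.le_abs_fl (IsFloat.zpow (by omega) _) hk1)
    refine le_trans ?_ hulp
    have h2k : machineEps p / 2 * 2 ^ ((p : ℤ) + k) = 2 ^ k := by
      rw [machineEps, zpow_add₀ two_ne_zero, zpow_sub₀ two_ne_zero]
      field_simp
    rw [zpow_sub₀ two_ne_zero, zpow_one] at hround
    have hK : (0 : ℝ) < 2 ^ k := by positivity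
    generalize (2 : ℝ) ^ k = K at *
    generalize (2 : ℝ) ^ ((p : ℤ) + k) = P at *
    generalize machineEps p = ε at *
    have h1 := abs_sub_abs_le_abs_sub S y
    have h2 : (1 - 3 / 160) * |S| ≤ P := by nlinarith [abs_nonneg S]
    have h3 : |S - y| ≤ 3 / 10 * (160 / 157) * K := by
      have : ε / 2 * |S| ≤ 160 / 157 * K := by nlinarith
      linarith
    have h4 : |S - fl y| ≤ (1 / 2 + 48 / 157) * K := by
      linarith [abs_sub_le S y (fl y)]
    have h5 : |s'| - |S - fl y| ≤ |S - fl y - s'| := by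
      have := abs_sub_abs_le_abs_sub s' (S - fl y)
      rwa [abs_sub_comm s'] at this
    nlinarith [abs_nonneg (S - fl y)]

/-! ### Rounding a sum to an expansion -/

/-- The `j`-th term of the expansion of an exact sum: the leading float of the residual left by
the earlier terms. -/
def term : ℕ → List (FloatExpr ι) → FloatExpr ι
  | 0, l => lead l
  | j + 1, l => term j (neg (lead l) :: l)

theorem abs_term_succ_le (hfl : IsRoundToNearest p fl) (hp : 4 ≤ p) (hv : ∀ i, IsFloat p (v i))
    (j : ℕ) (l : List (FloatExpr ι)) :
    |(term (j + 1) l).eval fl v| ≤ ulp p ((term j l).eval fl v) := by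
  induction j generalizing l with
  | zero => exact abs_lead_residual_le hfl hp hv l
  | succ j ih => exact ih _

theorem isFPE_term (hfl : IsRoundToNearest p fl) (hp : 4 ≤ p) (hv : ∀ i, IsFloat p (v i))
    (t : ℕ) (l : List (FloatExpr ι)) :
    IsFPE p fun j : Fin t => (term j l).eval fl v := by
  refine ⟨fun j => isFloat_eval hfl hv _, fun i j hij => ?_⟩
  simp only [hij]
  exact abs_term_succ_le hfl hp hv i l

theorem sum_term_error (hfl : IsRoundToNearest p fl) (hp : 4 ≤ p) (hv : ∀ i, IsFloat p (v i))
    (t : ℕ) (l : List (FloatExpr ι)) :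
    |fpeValue (fun j : Fin t => (term j l).eval fl v) - total fl v l|
      ≤ (7 / 10 * machineEps p) ^ t * |total fl v l| := by
  have := machineEps_pos p
  induction t generalizing l with
  | zero => simp [fpeValue]
  | succ t ih =>
    have h := ih (neg (lead l) :: l)
    have hl := lead_error hfl hp hv l
    rw [total_cons, eval_neg hfl hv, neg_add_eq_sub] at h
    simp only [fpeValue, Fin.sum_univ_succ, Fin.val_zero, Fin.val_succ, term] at h ⊢
    rw [show ∀ a b c : ℝ, a + b - c = b - (c - a) by intros; ring]
    refine h.trans ?_
    rw [pow_succ, mul_assoc]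
    gcongr

end FloatExpr

noncomputable section

/-! ### The routines for expansions -/

namespace FloatExpr

variable {ι κ : Type} {t p : ℕ} {fl : ℝ → ℝ}

/-- The terms of the `k`-th operand. -/
def operand (t : ℕ) (k : κ) : List (FloatExpr (κ × Fin t)) :=
  (List.finRange t).map fun j => var (k, j)

theorem total_operand (a : κ → Fin t → ℝ) (k : κ) :
    total fl (fun q : κ × Fin t => a q.1 q.2) (operand t k) = fpeValue (a k) := by
  simp [total, operand, fpeValue, Fin.sum_univ_def, Function.comp_def, eval]

theorem total_flatMap_operand {n : ℕ} (a : Fin n → Fin t → ℝ) :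
    total fl (fun q : Fin n × Fin t => a q.1 q.2) ((List.finRange n).flatMap (operand t))
      = ∑ k, fpeValue (a k) := by
  rw [Fin.sum_univ_def]
  induction List.finRange n with
  | nil => simp
  | cons k l ih => simp [ih, total_operand]

/-- The digits of the long division of `l` by `l'`, latest first: each digit divides the leading
float of the exact remainder by the leading float of the divisor. -/
def quotientDigits (l l' : List (FloatExpr ι)) : ℕ → List (FloatExpr ι)
  | 0 => []
  | k + 1 =>
    div (lead (l ++ prodTerms ((quotientDigits l l' k).map neg) l')) (lead l')
      :: quotientDigits l l' k

theorem quotientDigits_error {v : ι → ℝ} (hfl : IsRoundToNearest p fl) (hp : 4 ≤ p)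
    (hv : ∀ i, IsFloat p (v i)) (l l' : List (FloatExpr ι)) (h0 : total fl v l' ≠ 0) (k : ℕ) :
    |total fl v l - total fl v (quotientDigits l l' k) * total fl v l'|
      ≤ (1 / 2) ^ k * |total fl v l| := by
  induction k with
  | zero => simp [quotientDigits]
  | succ k ih =>
    have h1 := lead_error hfl hp hv (l ++ prodTerms ((quotientDigits l l' k).map neg) l')
    have h2 := lead_error hfl hp hv l'
    simp only [quotientDigits, total_cons, eval]
    rw [total_append, total_prodTerms hfl (by omega) hv, total_map_neg hfl hv, neg_mul,
      ← sub_eq_add_neg] at h1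
    generalize (lead (l ++ prodTerms ((quotientDigits l l' k).map neg) l')).eval fl v = ρ at *
    generalize (lead l').eval fl v = β at *
    have h3 := hfl.abs_sub_fl_le_mul (by omega) (ρ / β)
    have hε := machineEps_pos p
    have hε8 := machineEps_le hp
    generalize fl (ρ / β) = q at *
    generalize machineEps p = ε at *
    have hrw : total fl v l - (q + total fl v (quotientDigits l l' k)) * total fl v l'
        = total fl v l - total fl v (quotientDigits l l' k) * total fl v l'
          - q * total fl v l' := by ring
    rw [hrw]
    generalize total fl v l - total fl v (quotientDigits l l' k) * total fl v l' = r at *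
    generalize total fl v l' = b at *
    have hb : 0 < |b| := abs_pos.2 h0
    have hκ : 7 / 10 * ε ≤ 7 / 80 := by linarith
    have h1' : |r - ρ| ≤ 7 / 80 * |r| := h1.trans (by gcongr)
    have h2' : |b - β| ≤ 7 / 80 * |b| := h2.trans (by gcongr)
    have hβb : 73 / 80 * |b| ≤ |β| := by linarith [abs_sub_abs_le_abs_sub b β]
    have hβ : β ≠ 0 := abs_pos.1 (by linarith)
    have hρ : |ρ| ≤ 87 / 80 * |r| := by
      have := abs_sub_abs_le_abs_sub ρ r
      rw [abs_sub_comm] at this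
      linarith
    have hc : |ρ / β| * |b| ≤ 87 / 73 * |r| := by
      have : |ρ / β| * |β| = |ρ| := by rw [← abs_mul, div_mul_cancel₀ _ hβ]
      nlinarith [abs_nonneg (ρ / β)]
    have h4 : |r - q * b| ≤ |r - ρ| + |ρ / β| * |b - β| + |ρ / β - q| * |b| := by
      rw [← abs_mul, ← abs_mul]
      have : r - q * b = (r - ρ) + -(ρ / β * (b - β)) + (ρ / β - q) * b := by
        field_simp
        ring
      rw [this]
      refine (abs_add_le _ _).trans ?_
      gcongr
      exact (abs_add_le _ _).trans_eq (by rw [abs_neg])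
    have h5 : |ρ / β - q| * |b| ≤ 1 / 16 * (|ρ / β| * |b|) := by
      rw [← mul_assoc]
      have : |ρ / β - q| ≤ 1 / 16 * |ρ / β| :=
        h3.trans (mul_le_mul_of_nonneg_right (by linarith) (abs_nonneg _))
      gcongr
    have h6 : |ρ / β| * |b - β| ≤ 7 / 80 * (|ρ / β| * |b|) := by
      nlinarith [abs_nonneg (ρ / β)]
    have h7 : |r - q * b| ≤ 1 / 2 * |r| := by linarith [abs_nonneg r]
    refine h7.trans ?_
    rw [pow_succ]
    linarith

end FloatExpr

open FloatExpr

/-- Sums and products are collected exactly as lists of floats and rounded to an expansion; for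
quotients the list consists of the digits of a long division. With `p t + 4` digits, each of which
at least halves the remainder, the truncation error is below the final rounding error. -/
def exactListRoutines (p t : ℕ) : FPERoutines t where
  sum n j := term j ((List.finRange n).flatMap (operand t))
  mul j := term j (prodTerms (operand t 0) (operand t 1))
  div j := term j (quotientDigits (operand t 0) (operand t 1) (p * t + 4))

namespace exactListRoutines

variable {p t : ℕ} {fl : ℝ → ℝ}

theorem isFPE_runSum (hfl : IsRoundToNearest p fl) (hp : 4 ≤ p) {n : ℕ}
    {a : Fin n → Fin t → ℝ} (ha : ∀ i, IsFPE p (a i)) :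
    IsFPE p ((exactListRoutines p t).runSum fl a) :=
  isFPE_term (v := fun q : Fin n × Fin t => a q.1 q.2) hfl hp (fun q => (ha q.1).1 q.2) t _

theorem runSum_error (hfl : IsRoundToNearest p fl) (hp : 4 ≤ p) {n : ℕ}
    {a : Fin n → Fin t → ℝ} (ha : ∀ i, IsFPE p (a i)) :
    |fpeValue ((exactListRoutines p t).runSum fl a) - ∑ i, fpeValue (a i)|
      ≤ (7 / 10 * machineEps p) ^ t * |∑ i, fpeValue (a i)| := by
  rw [← total_flatMap_operand (fl := fl)]
  exact sum_term_error (v := fun q : Fin n × Fin t => a q.1 q.2) hfl hp (fun q => (ha q.1).1 q.2) t _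

theorem runSum_zero_error (hfl : IsRoundToNearest p fl) (hp : 4 ≤ p) (ht : 1 ≤ t) {n : ℕ}
    {a : Fin n → Fin t → ℝ} (ha : ∀ i, IsFPE p (a i)) :
    |∑ i, fpeValue (a i) - (exactListRoutines p t).runSum fl a ⟨0, ht⟩|
      ≤ 7 / 10 * machineEps p * |∑ i, fpeValue (a i)| := by
  rw [← total_flatMap_operand (fl := fl)]
  exact lead_error (v := fun q : Fin n × Fin t => a q.1 q.2) hfl hp (fun q => (ha q.1).1 q.2) _

theorem one_le_runSum_zero (hfl : IsRoundToNearest p fl) (hp : 4 ≤ p) (ht : 1 ≤ t) {n : ℕ}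
    {a : Fin n → Fin t → ℝ} (ha : ∀ i, IsFPE p (a i)) (h : 1 ≤ ∑ i, fpeValue (a i)) :
    1 ≤ (exactListRoutines p t).runSum fl a ⟨0, ht⟩ := by
  rw [← total_flatMap_operand (fl := fl)] at h
  exact one_le_lead (v := fun q : Fin n × Fin t => a q.1 q.2) hfl hp (fun q => (ha q.1).1 q.2) h

theorem isFloat_pair {a b : Fin t → ℝ} (ha : IsFPE p a) (hb : IsFPE p b)
    (q : Fin 2 × Fin t) : IsFloat p ((![a, b] : Fin 2 → Fin t → ℝ) q.1 q.2) := by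
  obtain ⟨k, j⟩ := q
  fin_cases k
  · exact ha.1 j
  · exact hb.1 j

theorem isFPE_runMul (hfl : IsRoundToNearest p fl) (hp : 4 ≤ p) {a b : Fin t → ℝ}
    (ha : IsFPE p a) (hb : IsFPE p b) : IsFPE p ((exactListRoutines p t).runMul fl a b) :=
  isFPE_term hfl hp (isFloat_pair ha hb) t _

theorem runMul_error (hfl : IsRoundToNearest p fl) (hp : 4 ≤ p) {a b : Fin t → ℝ}
    (ha : IsFPE p a) (hb : IsFPE p b) :
    |fpeValue ((exactListRoutines p t).runMul fl a b) - fpeValue a * fpeValue b|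
      ≤ (7 / 10 * machineEps p) ^ t * |fpeValue a * fpeValue b| := by
  have h := sum_term_error hfl hp (isFloat_pair ha hb) t (prodTerms (operand t 0) (operand t 1))
  rwa [total_prodTerms hfl (by omega) (isFloat_pair ha hb), total_operand, total_operand] at h

theorem isFPE_runDiv (hfl : IsRoundToNearest p fl) (hp : 4 ≤ p) {a b : Fin t → ℝ}
    (ha : IsFPE p a) (hb : IsFPE p b) : IsFPE p ((exactListRoutines p t).runDiv fl a b) :=
  isFPE_term hfl hp (isFloat_pair ha hb) t _

theorem runDiv_error (hfl : IsRoundToNearest p fl) (hp : 4 ≤ p) (ht : 1 ≤ t) {a b : Fin t → ℝ}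
    (ha : IsFPE p a) (hb : IsFPE p b) (hb0 : fpeValue b ≠ 0) :
    |fpeValue ((exactListRoutines p t).runDiv fl a b) - fpeValue a / fpeValue b|
      ≤ machineEps p ^ t * |fpeValue a / fpeValue b| := by
  have hv := isFloat_pair ha hb
  have h1 := sum_term_error hfl hp hv t
    (quotientDigits (operand t 0) (operand t 1) (p * t + 4))
  have h2 := quotientDigits_error hfl hp hv (operand t 0) (operand t 1)
    (by rwa [total_operand]) (p * t + 4)
  rw [total_operand, total_operand] at h2
  change |fpeValue ((exactListRoutines p t).runDiv fl a b) - _| ≤ _ at h1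
  generalize fpeValue ((exactListRoutines p t).runDiv fl a b) = s at *
  generalize total fl (fun q => (![a, b] : Fin 2 → Fin t → ℝ) q.1 q.2)
    (quotientDigits (operand t 0) (operand t 1) (p * t + 4)) = q at *
  simp only [Matrix.cons_val_zero, Matrix.cons_val_one] at h2
  generalize fpeValue a = x at *
  generalize fpeValue b = y at *
  have h3 : |x / y - q| ≤ (1 / 2) ^ (p * t + 4) * |x / y| := by
    have hy : 0 < |y| := abs_pos.2 hb0
    rw [abs_div, ← mul_div_assoc, le_div_iff₀ hy, ← abs_mul, sub_mul, div_mul_cancel₀ _ hb0]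
    exact h2
  have hε := machineEps_pos p
  have hδ : (1 / 2 : ℝ) ^ (p * t + 4) ≤ 1 / 16 * machineEps p ^ t := by
    have : (1 / 2 : ℝ) ^ p ≤ machineEps p := by
      rw [machineEps, zpow_sub₀ two_ne_zero, zpow_natCast, one_div_pow, zpow_one]
      gcongr
      norm_num
    rw [pow_add, pow_mul, mul_comm]
    gcongr
    norm_num
  have hκ : (7 / 10 * machineEps p) ^ t ≤ 7 / 10 * machineEps p ^ t := by
    rw [mul_pow]
    gcongr
    exact pow_le_of_le_one (by norm_num) (by norm_num) (by omega)
  have hle : machineEps p ^ t ≤ 1 := pow_le_one₀ hε.le (by linarith [machineEps_le hp])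
  have hpos : 0 < machineEps p ^ t := by positivity
  generalize machineEps p ^ t = e at *
  generalize (1 / 2 : ℝ) ^ (p * t + 4) = δ at *
  generalize (7 / 10 * machineEps p) ^ t = κ at *
  have hQ := abs_nonneg (x / y)
  have h4 : |x / y - q| ≤ 1 / 16 * e * |x / y| := h3.trans (by gcongr)
  have h5 : |s - q| ≤ 7 / 10 * e * |q| := h1.trans (by gcongr)
  have h6 : |q| ≤ 17 / 16 * |x / y| := by
    have := abs_sub_abs_le_abs_sub q (x / y)
    rw [abs_sub_comm] at this
    nlinarith
  have h7 : |s - x / y| ≤ |s - q| + |x / y - q| := by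
    rw [abs_sub_comm (x / y)]
    exact abs_sub_le _ _ _
  have h8 : e * |q| ≤ e * (17 / 16 * |x / y|) := by gcongr
  nlinarith [mul_nonneg hpos.le hQ]

theorem isAccurate (hp : 4 ≤ p) (ht : 1 ≤ t) : (exactListRoutines p t).IsAccurate p := by
  have hκ : (7 / 10 * machineEps p) ^ t ≤ machineEps p ^ t := by
    have := machineEps_pos p
    gcongr
    linarith
  refine fun fl hfl => ⟨fun n a ha => ⟨isFPE_runSum hfl hp ha, ?_⟩,
    fun a b ha hb => ⟨isFPE_runMul hfl hp ha hb, ?_⟩,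
    fun a b ha hb hb0 => ⟨isFPE_runDiv hfl hp ha hb, runDiv_error hfl hp ht ha hb hb0⟩⟩
  · exact (runSum_error hfl hp ha).trans (by gcongr)
  · exact (runMul_error hfl hp ha hb).trans (by gcongr)

end exactListRoutines

end

/-! ### Inverse hyperbolic cosine -/

theorem arcosh_sub_arcosh_le {a b c δ : ℝ} (ha : 1 ≤ a) (hb : 1 ≤ b) (hδ : 0 ≤ δ)
    (hc : c ≤ Real.cosh δ) (hab : b ≤ c * a) : Real.arcosh b - Real.arcosh a ≤ δ := by
  by_contra! h
  have hα := Real.arcosh_nonneg ha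
  have h1 : Real.cosh (Real.arcosh a + δ) < Real.cosh (Real.arcosh b) := by
    rw [Real.cosh_lt_cosh, abs_of_nonneg (by linarith), abs_of_nonneg (by linarith)]
    linarith
  rw [Real.cosh_add, Real.cosh_arcosh ha, Real.cosh_arcosh hb] at h1
  have h2 := mul_nonneg (Real.sinh_nonneg_iff.2 hα) (Real.sinh_nonneg_iff.2 hδ)
  nlinarith

theorem one_add_sq_div_two_le_cosh {x : ℝ} (hx : 0 ≤ x) : 1 + x ^ 2 / 2 ≤ Real.cosh x := by
  have h1 := Real.self_le_sinh_iff.2 (by linarith : 0 ≤ x / 2)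
  have h2 := Real.cosh_two_mul (x / 2)
  rw [mul_div_cancel₀ x two_ne_zero, Real.cosh_sq] at h2
  nlinarith

theorem sqrt_le_arcosh_one_add {ε : ℝ} (h0 : 0 ≤ ε) (h1 : ε ≤ 1) :
    √ε ≤ Real.arcosh (1 + ε) := by
  rw [← Real.arcosh_cosh (Real.sqrt_nonneg ε),
    Real.arcosh_le_arcosh (Real.cosh_pos _) (by linarith)]
  refine (Real.cosh_le_exp_half_sq _).trans ?_
  rw [Real.sq_sqrt h0]
  have h2 := Real.one_sub_le_exp_neg (ε / 2)
  have h3 : Real.exp (ε / 2) * Real.exp (-(ε / 2)) = 1 := by rw [← Real.exp_add]; simp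
  have h4 := Real.exp_pos (ε / 2)
  nlinarith [mul_nonneg h0 (sub_nonneg.2 h1)]

/-- Evaluated at the float `1`, a floating-point inverse hyperbolic cosine must serve both
`arcosh 1` and `arcosh (1 + ε)`, so its accuracy cannot be much better than `√ε / 2`. -/
theorem IsFloatArcosh.sqrt_machineEps_lt {p : ℕ} (hp : 1 ≤ p) {R ε₁ : ℝ} {A : ℝ → ℝ}
    (hA : IsFloatArcosh p R ε₁ A) (hR : 2 ≤ R) : √(machineEps p) < 2 * ε₁ := by
  have hε := machineEps_pos p
  have hε1 := machineEps_le_one hp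
  have one : IsFloat p 1 := by simpa using IsFloat.zpow hp 0
  have h1 := hA 1 1 le_rfl (by linarith) one le_rfl (by linarith) (by simpa)
  have h2 := hA (1 + machineEps p) 1 (by linarith) (by linarith) one le_rfl (by linarith) (by
    rw [abs_of_pos (a := 1 + machineEps p) (by linarith), sub_add_cancel_left, abs_neg,
      abs_of_pos hε]
    nlinarith)
  have h3 := sqrt_le_arcosh_one_add hε.le hε1
  rw [Real.arcosh_zero] at h1
  rw [abs_lt] at h1 h2
  linarith

/-- A relative error of a few `ε` in the argument changes `arcosh` by a few `√ε`, which the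
accuracy of the floating-point function already allows for. -/
theorem IsFloatArcosh.abs_sub_lt {p : ℕ} (hp : 1 ≤ p) {R ε₁ : ℝ} {A : ℝ → ℝ}
    (hA : IsFloatArcosh p R ε₁ A) {z f : ℝ} (hz : 1 ≤ z) (hzR : 2 * z ≤ R) (hf : IsFloat p f)
    (hf1 : 1 ≤ f) (hfR : f ≤ R) (h1 : f ≤ (1 + 28 * machineEps p) * z)
    (h2 : z ≤ (1 + 28 * machineEps p) * f) : |A f - Real.arcosh z| < 16 * ε₁ := by
  have hε := machineEps_pos p
  have hs := hA.sqrt_machineEps_lt hp (by linarith)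
  have hAf := hA f f hf1 hfR hf hf1 hfR (by
    rw [sub_self, abs_zero]; exact mul_pos hε (abs_pos.2 (by linarith)))
  have hsq := Real.sq_sqrt hε.le
  have hc : 1 + 28 * machineEps p ≤ Real.cosh (15 / 2 * √(machineEps p)) := by
    refine le_trans ?_ (one_add_sq_div_two_le_cosh (by positivity))
    rw [mul_pow, hsq]
    linarith
  have hδ : 0 ≤ 15 / 2 * √(machineEps p) := by positivity
  have h3 := arcosh_sub_arcosh_le hz hf1 hδ hc h1
  have h4 := arcosh_sub_arcosh_le hf1 hz hδ hc h2
  rw [abs_lt] at hAf ⊢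
  constructor <;> linarith

/-! ### Expansions -/

theorem ulp_le {p : ℕ} (x : ℝ) : ulp p x ≤ machineEps p * |x| := by
  rcases eq_or_ne x 0 with rfl | hx
  · simp [ulp]
  · have h := Int.zpow_log_le_self (b := 2) one_lt_two (abs_pos.2 hx)
    rw [ulp, if_neg hx, add_sub_assoc, zpow_add₀ two_ne_zero, machineEps, mul_comm]
    push_cast at h
    gcongr

namespace IsFPE

variable {p t : ℕ} {f : Fin t → ℝ}

theorem neg (hf : IsFPE p f) : IsFPE p (-f) :=
  ⟨fun i => (hf.1 i).neg, fun i j hij => by simpa [ulp] using hf.2 i j hij⟩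

theorem fpeOfFloat {c : ℝ} (hc : IsFloat p c) : IsFPE p (fpeOfFloat t c) := by
  refine ⟨fun i => ?_, fun i j hij => ?_⟩
  · unfold _root_.fpeOfFloat
    split_ifs
    · exact hc
    · exact IsFloat.zero p
  · have : _root_.fpeOfFloat t c j = 0 := if_neg (by omega)
    rw [this, abs_zero, ulp]
    split_ifs <;> positivity

/-- Every later term of an expansion is smaller than the leading term by a factor `ε`. -/
theorem abs_le_mul_abs_zero (hp : 1 ≤ p) (hf : IsFPE p f) (ht : 1 ≤ t) (j : Fin t)
    (hj : j ≠ ⟨0, ht⟩) : |f j| ≤ machineEps p * |f ⟨0, ht⟩| := by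
  have hε := machineEps_pos p
  have hε1 := machineEps_le_one hp
  obtain ⟨k, hk⟩ := j
  induction k with
  | zero => exact absurd rfl hj
  | succ k ih =>
    have h1 := (hf.2 ⟨k, by omega⟩ ⟨k + 1, hk⟩ rfl).trans (ulp_le _)
    rcases Nat.eq_zero_or_pos k with rfl | hk0
    · exact h1
    · refine h1.trans ?_
      have := ih (by omega) (by simp; omega)
      exact mul_le_mul_of_nonneg_left
        (this.trans (mul_le_of_le_one_left (abs_nonneg _) hε1)) hε.le

end IsFPE

theorem fpeValue_neg {t : ℕ} (f : Fin t → ℝ) : fpeValue (-f) = -fpeValue f := by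
  simp [fpeValue]

theorem fpeValue_fpeOfFloat {t : ℕ} (ht : 1 ≤ t) (c : ℝ) : fpeValue (fpeOfFloat t c) = c := by
  obtain ⟨t, rfl⟩ := Nat.exists_eq_add_of_le' ht
  simp [fpeValue, fpeOfFloat]

/-! ### Real estimates for the argument of the inverse hyperbolic cosine -/

/-- Computed factors `1 - ‖x‖ ^ 2` stay positive, so the division is never by zero. -/
theorem ne_zero_of_factor_bounds {ε g A B A' B' P : ℝ} (hA : 0 < A) (hB : 0 < B) (hε8 : ε ≤ 1 / 8)
    (hg : g < 1) (hA1 : (1 - 31 / 20 * ε) * (1 - g) * A ≤ A')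
    (hB1 : (1 - 31 / 20 * ε) * (1 - g) * B ≤ B') (hP : |P - A' * B'| ≤ g * |A' * B'|) :
    P ≠ 0 := by
  have h1 : 0 < 1 - 31 / 20 * ε := by linarith
  have h2 : 0 < 1 - g := by linarith
  have hA' : 0 < A' := lt_of_lt_of_le (by positivity) hA1
  have hB' : 0 < B' := lt_of_lt_of_le (by positivity) hB1
  have h3 := mul_pos hA' hB'
  rintro rfl
  rw [zero_sub, abs_neg, abs_of_pos h3] at hP
  nlinarith

theorem quotient_factor_lower {ε e g : ℝ} (hε : 0 < ε) (hε8 : ε ≤ 1 / 8) (hg0 : 0 ≤ g)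
    (hgε : g ≤ ε / 16) (heε : e ≤ ε / 8) :
    (1 - 4 * ε) * ((1 + g) ^ 3 * (1 + 31 / 20 * ε) ^ 2) ≤ (1 - e) * (1 - g) ^ 5 := by
  have h1 : 1 - 5 * g ≤ (1 - g) ^ 5 := by
    have := one_add_mul_le_pow (a := -g) (by linarith) 5
    push_cast at this
    linarith [this]
  have h2 : (1 + g) ^ 3 ≤ 1 + 16 / 5 * g := by
    nlinarith [mul_nonneg hg0 hg0, mul_nonneg (mul_nonneg hg0 hg0) hg0]
  have h4 : ((1 + g) ^ 3 * (1 + 31 / 20 * ε) ^ 2) ≤ (1 + ε / 5) * (1 + 31 / 20 * ε) ^ 2 := by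
    gcongr; linarith
  have h5 : (1 - ε / 8) * (1 - 5 / 16 * ε) ≤ (1 - e) * (1 - g) ^ 5 := by
    apply mul_le_mul <;> linarith
  have h6 : (1 - 4 * ε) * ((1 + g) ^ 3 * (1 + 31 / 20 * ε) ^ 2)
      ≤ (1 - 4 * ε) * ((1 + ε / 5) * (1 + 31 / 20 * ε) ^ 2) :=
    mul_le_mul_of_nonneg_left h4 (by linarith)
  refine h6.trans (le_trans ?_ h5)
  nlinarith [mul_pos hε hε, mul_pos hε (mul_pos hε hε)]

theorem quotient_factor_upper {ε e g : ℝ} (hε : 0 < ε) (hε8 : ε ≤ 1 / 8) (hg0 : 0 ≤ g)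
    (hgε : g ≤ ε / 16) (heε : e ≤ ε / 8) :
    (1 + e) * (1 + g) ^ 5 ≤ (1 + 27 / 5 * ε) * ((1 - g) ^ 3 * (1 - 31 / 20 * ε) ^ 2) := by
  have h1 : 1 - 3 / 16 * ε ≤ (1 - g) ^ 3 := by
    have := one_add_mul_le_pow (a := -g) (by linarith) 3
    push_cast at this
    linarith [this]
  have h2 : (1 + e) * (1 + g) ^ 5 ≤ (1 + ε / 8) * (1 + ε / 16) ^ 5 := by gcongr
  have h3 : (1 + ε / 16) ^ 5 ≤ 1 + 33 / 100 * ε := by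
    have h : (1 + ε / 16) ^ 2 ≤ 1 + 127 / 1000 * ε := by nlinarith
    calc (1 + ε / 16) ^ 5 = (1 + ε / 16) ^ 2 * (1 + ε / 16) ^ 2 * (1 + ε / 16) := by ring
      _ ≤ (1 + 127 / 1000 * ε) * (1 + 127 / 1000 * ε) * (1 + ε / 16) := by gcongr
      _ ≤ 1 + 33 / 100 * ε := by nlinarith [mul_pos hε hε, mul_pos hε (mul_pos hε hε)]
  have h4 : (1 + ε / 8) * (1 + ε / 16) ^ 5 ≤ (1 + ε / 8) * (1 + 33 / 100 * ε) := by gcongr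
  have h5 : (1 - 3 / 16 * ε) * (1 - 31 / 20 * ε) ^ 2 ≤ (1 - g) ^ 3 * (1 - 31 / 20 * ε) ^ 2 := by
    gcongr
  have h6 : (1 + 27 / 5 * ε) * ((1 - 3 / 16 * ε) * (1 - 31 / 20 * ε) ^ 2)
      ≤ (1 + 27 / 5 * ε) * ((1 - g) ^ 3 * (1 - 31 / 20 * ε) ^ 2) := by gcongr
  refine (h2.trans h4).trans (le_trans ?_ h6)
  nlinarith [mul_pos hε hε, mul_pos hε (mul_pos hε hε),
    mul_nonneg hε.le (sub_nonneg.2 hε8), mul_nonneg (mul_pos hε hε).le (sub_nonneg.2 hε8),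
    mul_nonneg hε.le (mul_nonneg (sub_nonneg.2 hε8) (sub_nonneg.2 hε8)),
    mul_nonneg (mul_pos hε (mul_pos hε hε)).le (sub_nonneg.2 hε8)]

/-- The errors of the quotient `2 D² / (A B)` when numerator, factors and operations carry relative
errors: the factors `1 - ‖x‖²` dominate, with relative error close to `3 ε / 2`. -/
theorem quotient_bounds {ε e g A B A' B' N M P q D : ℝ} (hε : 0 < ε) (hε8 : ε ≤ 1 / 8)
    (he : 0 ≤ e) (heε : e ≤ ε / 8) (hg : g = e / 2) (hA : 0 < A) (hB : 0 < B)
    (hA1 : (1 - 31 / 20 * ε) * (1 - g) * A ≤ A') (hA2 : A' ≤ (1 + 31 / 20 * ε) * (1 + g) * A)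
    (hB1 : (1 - 31 / 20 * ε) * (1 - g) * B ≤ B') (hB2 : B' ≤ (1 + 31 / 20 * ε) * (1 + g) * B)
    (hN1 : (1 - g) ^ 4 * D ^ 2 ≤ N) (hN2 : N ≤ (1 + g) ^ 4 * D ^ 2)
    (hM : |M - 2 * N| ≤ g * |2 * N|) (hP : |P - A' * B'| ≤ g * |A' * B'|)
    (hq : |q - M / P| ≤ e * |M / P|) :
    0 ≤ q ∧ 2 * (1 - 4 * ε) * D ^ 2 ≤ q * (A * B) ∧
      q * (A * B) ≤ 2 * (1 + 27 / 5 * ε) * D ^ 2 := by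
  have hg0 : 0 ≤ g := by linarith
  have hgε : g ≤ ε / 16 := by linarith
  have h1g : 0 < 1 - g := by linarith
  have h1ε : 0 < 1 - 31 / 20 * ε := by linarith
  have hN0 : 0 ≤ N := le_trans (by positivity) hN1
  have hA'0 : 0 < A' := lt_of_lt_of_le (by positivity) hA1
  have hB'0 : 0 < B' := lt_of_lt_of_le (by positivity) hB1
  rw [abs_of_nonneg (a := 2 * N) (by positivity), abs_le] at hM
  rw [abs_of_nonneg (a := A' * B') (by positivity), abs_le] at hP
  have hAB1 : ((1 - 31 / 20 * ε) * (1 - g) * A) * ((1 - 31 / 20 * ε) * (1 - g) * B) ≤ A' * B' := by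
    gcongr
  have hAB2 : A' * B' ≤ ((1 + 31 / 20 * ε) * (1 + g) * A) * ((1 + 31 / 20 * ε) * (1 + g) * B) := by
    gcongr
  have hP1 : (1 - g) ^ 3 * (1 - 31 / 20 * ε) ^ 2 * (A * B) ≤ P := by
    have := mul_le_mul_of_nonneg_left hAB1 h1g.le
    linarith
  have hP2 : P ≤ (1 + g) ^ 3 * (1 + 31 / 20 * ε) ^ 2 * (A * B) := by
    have := mul_le_mul_of_nonneg_left hAB2 (by linarith : 0 ≤ 1 + g)
    linarith
  have hM1 : 2 * (1 - g) ^ 5 * D ^ 2 ≤ M := by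
    have := mul_le_mul_of_nonneg_left hN1 h1g.le
    linarith
  have hM2 : M ≤ 2 * (1 + g) ^ 5 * D ^ 2 := by
    have := mul_le_mul_of_nonneg_left hN2 (by linarith : 0 ≤ 1 + g)
    linarith
  have hP0 : 0 < P := lt_of_lt_of_le (by positivity) hP1
  have hM0 : 0 ≤ M := le_trans (by positivity) hM1
  rw [abs_of_nonneg (a := M / P) (by positivity), abs_le] at hq
  have hq1 : (1 - e) * M ≤ q * P := by
    have : (1 - e) * (M / P) ≤ q := by linarith
    rwa [← mul_div_assoc, div_le_iff₀ hP0] at this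
  have hq2 : q * P ≤ (1 + e) * M := by
    have : q ≤ (1 + e) * (M / P) := by linarith
    rwa [← mul_div_assoc, le_div_iff₀ hP0] at this
  have hq0 : 0 ≤ q := by
    have : 0 ≤ q * P := le_trans (mul_nonneg (by linarith) hM0) hq1
    exact nonneg_of_mul_nonneg_left this hP0
  have hD := sq_nonneg D
  refine ⟨hq0, ?_, ?_⟩
  · set κ := (1 + g) ^ 3 * (1 + 31 / 20 * ε) ^ 2 with hκ
    have hκ0 : 0 < κ := by positivity
    have key : (1 - 4 * ε) * κ ≤ (1 - e) * (1 - g) ^ 5 :=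
      quotient_factor_lower hε hε8 hg0 hgε heε
    have : κ * (2 * (1 - 4 * ε) * D ^ 2) ≤ κ * (q * (A * B)) := by
      calc κ * (2 * (1 - 4 * ε) * D ^ 2) = (1 - 4 * ε) * κ * (2 * D ^ 2) := by ring
        _ ≤ (1 - e) * (1 - g) ^ 5 * (2 * D ^ 2) := by gcongr
        _ = (1 - e) * (2 * (1 - g) ^ 5 * D ^ 2) := by ring
        _ ≤ (1 - e) * M := mul_le_mul_of_nonneg_left hM1 (by linarith)
        _ ≤ q * P := hq1
        _ ≤ q * (κ * (A * B)) := by gcongr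
        _ = κ * (q * (A * B)) := by ring
    exact le_of_mul_le_mul_left this hκ0
  · set κ := (1 - g) ^ 3 * (1 - 31 / 20 * ε) ^ 2 with hκ
    have hκ0 : 0 < κ := by positivity
    have key : (1 + e) * (1 + g) ^ 5 ≤ (1 + 27 / 5 * ε) * κ :=
      quotient_factor_upper hε hε8 hg0 hgε heε
    have : κ * (q * (A * B)) ≤ κ * (2 * (1 + 27 / 5 * ε) * D ^ 2) := by
      calc κ * (q * (A * B)) = q * (κ * (A * B)) := by ring
        _ ≤ q * P := by gcongr
        _ ≤ (1 + e) * M := hq2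
        _ ≤ (1 + e) * (2 * (1 + g) ^ 5 * D ^ 2) := by gcongr
        _ = (1 + e) * (1 + g) ^ 5 * (2 * D ^ 2) := by ring
        _ ≤ (1 + 27 / 5 * ε) * κ * (2 * D ^ 2) := by gcongr
        _ = κ * (2 * (1 + 27 / 5 * ε) * D ^ 2) := by ring
    exact le_of_mul_le_mul_left this hκ0

/-- An absolute error `ε` in `w` and a relative error of a few `ε` in the quotient give a relative
error of a few `ε` in `1 + 2 w²`. The constant `8` matters: it makes the upper bound at most
`2 (1 + 2 w²)` for all `ε ≤ 1 / 8`. -/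
theorem leading_term_bounds {ε w w' q f : ℝ} (hε : 0 < ε) (hε8 : ε ≤ 1 / 8) (hw : 0 ≤ w)
    (hw' : 0 ≤ w') (hww : |w' - w| ≤ ε) (hq0 : 0 ≤ q) (hq1 : 2 * (1 - 4 * ε) * w' ^ 2 ≤ q)
    (hq2 : q ≤ 2 * (1 + 27 / 5 * ε) * w' ^ 2) (hf : |1 + q - f| ≤ 7 / 10 * ε * |1 + q|) :
    f ≤ (1 + 8 * ε) * (1 + 2 * w ^ 2) ∧ 1 + 2 * w ^ 2 ≤ (1 + 28 * ε) * f := by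
  rw [abs_of_nonneg (a := 1 + q) (by linarith), abs_le] at hf
  rw [abs_le] at hww
  constructor
  · have h1 : w' ^ 2 ≤ (w + ε) ^ 2 := by gcongr; linarith
    have h2 : q ≤ 2 * (1 + 27 / 5 * ε) * (w + ε) ^ 2 := hq2.trans (by gcongr)
    have h3 : f ≤ (1 + 7 / 10 * ε) * (1 + q) := by linarith
    have hG : (1 + 7 / 10 * ε) * (1 + 27 / 5 * ε) ≤ 1 + 33 / 5 * ε := by nlinarith
    calc f ≤ (1 + 7 / 10 * ε) * (1 + 2 * (1 + 27 / 5 * ε) * (w + ε) ^ 2) :=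
          h3.trans (by gcongr)
      _ = 1 + 7 / 10 * ε + 2 * ((1 + 7 / 10 * ε) * (1 + 27 / 5 * ε)) * (w + ε) ^ 2 := by ring
      _ ≤ 1 + 7 / 10 * ε + 2 * (1 + 33 / 5 * ε) * (w + ε) ^ 2 := by gcongr
      _ = 1 + 7 / 10 * ε + 2 * w ^ 2 + 66 / 5 * ε * w ^ 2
          + ε * ((1 + 33 / 5 * ε) * (4 * w + 2 * ε)) := by ring
      _ ≤ 1 + 7 / 10 * ε + 2 * w ^ 2 + 66 / 5 * ε * w ^ 2
          + ε * ((1 + 33 / 5 * (1 / 8)) * (4 * w + 2 * (1 / 8))) := by gcongr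
      _ ≤ (1 + 8 * ε) * (1 + 2 * w ^ 2) := by
        have : (1 + 33 / 5 * (1 / 8)) * (4 * w + 2 * (1 / 8)) ≤ 73 / 10 + 14 / 5 * w ^ 2 := by
          nlinarith [sq_nonneg (w - 13 / 10)]
        nlinarith
  · have h1 : w ^ 2 * (1 - ε) - ε ≤ w' ^ 2 := by
      nlinarith [sq_nonneg (w - 1), sq_nonneg (w' - w), mul_nonneg hε.le (sq_nonneg (w - 1))]
    have h2 : 2 * (1 - 4 * ε) * (w ^ 2 * (1 - ε) - ε) ≤ q :=
      le_trans (mul_le_mul_of_nonneg_left h1 (by linarith)) hq1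
    have h3 : (1 - 5 * ε) * (1 + 2 * w ^ 2) ≤ 1 + q := by
      nlinarith [mul_pos hε hε, mul_nonneg (mul_pos hε hε).le (sq_nonneg w)]
    have h4 : (1 - 7 / 10 * ε) * (1 + q) ≤ f := by linarith
    have h5 : (1 - 7 / 10 * ε) * ((1 - 5 * ε) * (1 + 2 * w ^ 2)) ≤ f :=
      le_trans (mul_le_mul_of_nonneg_left h3 (by linarith)) h4
    have h6 : 1 ≤ (1 + 28 * ε) * ((1 - 7 / 10 * ε) * (1 - 5 * ε)) := by
      have : 1 - 57 / 10 * ε ≤ (1 - 7 / 10 * ε) * (1 - 5 * ε) := by nlinarith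
      nlinarith
    calc 1 + 2 * w ^ 2 ≤ (1 + 28 * ε) * ((1 - 7 / 10 * ε) * (1 - 5 * ε)) * (1 + 2 * w ^ 2) := by
          nlinarith [sq_nonneg w]
      _ = (1 + 28 * ε) * ((1 - 7 / 10 * ε) * ((1 - 5 * ε) * (1 + 2 * w ^ 2))) := by ring
      _ ≤ _ := by gcongr

noncomputable section

/-! ### Evaluation of the argument in expansion arithmetic -/

variable {p t n : ℕ} {fl : ℝ → ℝ}

/-- The point whose coordinates are the values of the given expansions. -/
def pointOf (X : Fin n → Fin t → ℝ) : EuclideanSpace ℝ (Fin n) :=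
  WithLp.toLp 2 fun i => fpeValue (X i)

theorem norm_le_mul_of_abs_le {u v : EuclideanSpace ℝ (Fin n)} {c : ℝ} (hc : 0 ≤ c)
    (h : ∀ i, |u i| ≤ c * |v i|) : ‖u‖ ≤ c * ‖v‖ := by
  refine le_of_sq_le_sq ?_ (by positivity)
  rw [mul_pow, EuclideanSpace.real_norm_sq_eq, EuclideanSpace.real_norm_sq_eq, Finset.mul_sum]
  refine Finset.sum_le_sum fun i _ => ?_
  rw [← sq_abs (u i), ← sq_abs (v i), ← mul_pow]
  gcongr
  exact h i

theorem IsFPERepr.norm_pointOf_sub_le {X : Fin n → Fin t → ℝ} {x : EuclideanSpace ℝ (Fin n)}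
    (h : IsFPERepr p X x) : ‖pointOf X - x‖ ≤ machineEps p ^ t * ‖x‖ := by
  have := machineEps_pos p
  exact norm_le_mul_of_abs_le (by positivity) fun i => (h i).2

/-- For `t ≥ 2` the sums and products are twice as accurate as required; this margin keeps the
leading term of the result at most `2 z`. -/
theorem pow_mul_machineEps_le (ht : 2 ≤ t) :
    (7 / 10 * machineEps p) ^ t ≤ machineEps p ^ t / 2 := by
  have := machineEps_pos p
  have h : (7 / 10 : ℝ) ^ t ≤ 1 / 2 :=
    (pow_le_pow_of_le_one (by norm_num) (by norm_num) ht).trans (by norm_num)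
  have := mul_le_mul_of_nonneg_right h (by positivity : 0 ≤ machineEps p ^ t)
  rw [mul_pow]
  linarith

/-- In units of `√((1 - ‖x‖ ^ 2) (1 - ‖y‖ ^ 2))`, the represented points are at the distance of
`x` and `y` up to an absolute error `ε`. -/
theorem abs_norm_pointOf_sub_le (ht : 2 ≤ t) {X Y : Fin n → Fin t → ℝ}
    {x y : EuclideanSpace ℝ (Fin n)}
    (hx : ‖x‖ < 1 - machineEps p ^ (t - 1)) (hy : ‖y‖ < 1 - machineEps p ^ (t - 1))
    (hX : IsFPERepr p X x) (hY : IsFPERepr p Y y) :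
    |‖pointOf X - pointOf Y‖ - ‖x - y‖|
      ≤ machineEps p * √((1 - ‖x‖ ^ 2) * (1 - ‖y‖ ^ 2)) := by
  have h1 : |‖pointOf X - pointOf Y‖ - ‖x - y‖| ≤ ‖pointOf X - x‖ + ‖pointOf Y - y‖ := by
    refine (abs_norm_sub_norm_le _ _).trans ?_
    rw [show pointOf X - pointOf Y - (x - y) = (pointOf X - x) - (pointOf Y - y) by abel]
    exact norm_sub_le _ _
  have h2 := hX.norm_pointOf_sub_le
  have h3 := hY.norm_pointOf_sub_le
  have hε := machineEps_pos p
  have hte : machineEps p ^ t = machineEps p * machineEps p ^ (t - 1) := by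
    rw [← pow_succ']; congr 1; omega
  have ha : 0 < machineEps p ^ (t - 1) := by positivity
  rw [hte] at h2 h3
  have hr := norm_nonneg x
  have hs := norm_nonneg y
  have key : ∀ {r s : ℝ}, 0 ≤ r → r ≤ s → s < 1 - machineEps p ^ (t - 1) →
      machineEps p ^ (t - 1) * r + machineEps p ^ (t - 1) * s
        ≤ √((1 - r ^ 2) * (1 - s ^ 2)) := by
    intro r s hr hrs hs
    have h4 : machineEps p ^ (t - 1) * (2 * s) ≤ 1 - s ^ 2 := by nlinarith
    have h5 : 1 - s ^ 2 ≤ √((1 - r ^ 2) * (1 - s ^ 2)) := by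
      apply Real.le_sqrt_of_sq_le
      rw [sq]
      gcongr
      nlinarith
    nlinarith
  have h6 : machineEps p ^ (t - 1) * ‖x‖ + machineEps p ^ (t - 1) * ‖y‖
      ≤ √((1 - ‖x‖ ^ 2) * (1 - ‖y‖ ^ 2)) := by
    rcases le_total ‖x‖ ‖y‖ with h | h
    · exact key hr h hy
    · rw [add_comm, mul_comm (1 - ‖x‖ ^ 2)]
      exact key hs h hx
  have := mul_le_mul_of_nonneg_left h6 hε.le
  linarith

namespace exactListRoutines

theorem isFPE_pair {a b : Fin t → ℝ} (ha : IsFPE p a) (hb : IsFPE p b) (i : Fin 2) :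
    IsFPE p ((![a, b] : Fin 2 → Fin t → ℝ) i) := by
  fin_cases i
  · exact ha
  · exact hb

theorem isFPE_runSub (hfl : IsRoundToNearest p fl) (hp : 4 ≤ p) {a b : Fin t → ℝ}
    (ha : IsFPE p a) (hb : IsFPE p b) : IsFPE p ((exactListRoutines p t).runSub fl a b) :=
  isFPE_runSum hfl hp (isFPE_pair ha hb.neg)

theorem runSub_error (hfl : IsRoundToNearest p fl) (hp : 4 ≤ p) (ht : 2 ≤ t) {a b : Fin t → ℝ}
    (ha : IsFPE p a) (hb : IsFPE p b) :
    |fpeValue ((exactListRoutines p t).runSub fl a b) - (fpeValue a - fpeValue b)|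
      ≤ machineEps p ^ t / 2 * |fpeValue a - fpeValue b| := by
  have h := runSum_error (t := t) hfl hp (isFPE_pair ha hb.neg)
  rw [Fin.sum_univ_two, Matrix.cons_val_zero, Matrix.cons_val_one, Matrix.cons_val_zero,
    fpeValue_neg, ← sub_eq_add_neg] at h
  exact h.trans (mul_le_mul_of_nonneg_right (pow_mul_machineEps_le ht) (abs_nonneg _))

theorem runMul_error_half (hfl : IsRoundToNearest p fl) (hp : 4 ≤ p) (ht : 2 ≤ t)
    {a b : Fin t → ℝ} (ha : IsFPE p a) (hb : IsFPE p b) :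
    |fpeValue ((exactListRoutines p t).runMul fl a b) - fpeValue a * fpeValue b|
      ≤ machineEps p ^ t / 2 * |fpeValue a * fpeValue b| :=
  (runMul_error hfl hp ha hb).trans
    (mul_le_mul_of_nonneg_right (pow_mul_machineEps_le ht) (abs_nonneg _))

theorem isFPE_runSqNorm (hfl : IsRoundToNearest p fl) (hp : 4 ≤ p) {M : Fin n → Fin t → ℝ}
    (hM : ∀ i, IsFPE p (M i)) : IsFPE p ((exactListRoutines p t).runSqNorm fl M) :=
  isFPE_runSum hfl hp fun i => isFPE_runMul hfl hp (hM i) (hM i)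

theorem runSqNorm_bounds (hfl : IsRoundToNearest p fl) (hp : 4 ≤ p) (ht : 2 ≤ t)
    {M : Fin n → Fin t → ℝ} (hM : ∀ i, IsFPE p (M i)) :
    (1 - machineEps p ^ t / 2) ^ 2 * ‖pointOf M‖ ^ 2
        ≤ fpeValue ((exactListRoutines p t).runSqNorm fl M) ∧
      fpeValue ((exactListRoutines p t).runSqNorm fl M)
        ≤ (1 + machineEps p ^ t / 2) ^ 2 * ‖pointOf M‖ ^ 2 := by
  have hε := machineEps_pos p
  have he1 : machineEps p ^ t ≤ 1 := pow_le_one₀ hε.le (machineEps_le_one (by omega))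
  have he0 : 0 < machineEps p ^ t := by positivity
  have h1 := (runSum_error (t := t) hfl hp fun i => isFPE_runMul hfl hp (hM i) (hM i)).trans
    (mul_le_mul_of_nonneg_right (pow_mul_machineEps_le ht) (abs_nonneg _))
  have h2 := fun i => runMul_error_half hfl hp ht (hM i) (hM i)
  change |fpeValue ((exactListRoutines p t).runSqNorm fl M) - _| ≤ _ at h1
  have hsq : ‖pointOf M‖ ^ 2 = ∑ i, fpeValue (M i) * fpeValue (M i) := by
    rw [EuclideanSpace.real_norm_sq_eq]
    simp [pointOf, sq]
  simp only [abs_mul_self, abs_le] at h2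
  rw [hsq]
  generalize fpeValue ((exactListRoutines p t).runSqNorm fl M) = N at *
  generalize machineEps p ^ t = e at *
  have h3 : (1 - e / 2) * ∑ i, fpeValue (M i) * fpeValue (M i)
      ≤ ∑ i, fpeValue ((exactListRoutines p t).runMul fl (M i) (M i)) := by
    rw [Finset.mul_sum]
    exact Finset.sum_le_sum fun i _ => by linarith [(h2 i).1]
  have h4 : ∑ i, fpeValue ((exactListRoutines p t).runMul fl (M i) (M i))
      ≤ (1 + e / 2) * ∑ i, fpeValue (M i) * fpeValue (M i) := by
    rw [Finset.mul_sum]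
    exact Finset.sum_le_sum fun i _ => by linarith [(h2 i).2]
  have h5 : 0 ≤ ∑ i, fpeValue (M i) * fpeValue (M i) :=
    Finset.sum_nonneg fun i _ => mul_self_nonneg _
  generalize ∑ i, fpeValue (M i) * fpeValue (M i) = S at *
  generalize ∑ i, fpeValue ((exactListRoutines p t).runMul fl (M i) (M i)) = T at *
  have h6 : 0 ≤ T := le_trans (mul_nonneg (by linarith) h5) h3
  rw [abs_of_nonneg h6, abs_le] at h1
  have h7 := mul_le_mul_of_nonneg_left h3 (by linarith : 0 ≤ 1 - e / 2)
  have h8 := mul_le_mul_of_nonneg_left h4 (by linarith : 0 ≤ 1 + e / 2)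
  constructor <;> linarith

/-- The computed value of `1 - ‖x‖ ^ 2`. The errors of the representation and of the squared norm
are about `3 ε ^ t ‖x‖ ^ 2`, and `2 ε ^ (t - 1) ‖x‖ ^ 2 ≤ 1 - ‖x‖ ^ 2` as long as `x` stays at
distance `ε ^ (t - 1)` from the boundary. -/
theorem one_sub_sqNorm_bounds (hfl : IsRoundToNearest p fl) (hp : 4 ≤ p) (ht : 2 ≤ t)
    {X : Fin n → Fin t → ℝ} {x : EuclideanSpace ℝ (Fin n)}
    (hx : ‖x‖ < 1 - machineEps p ^ (t - 1)) (hX : IsFPERepr p X x) :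
    IsFPE p ((exactListRoutines p t).runSub fl (fpeOfFloat t 1)
      ((exactListRoutines p t).runSqNorm fl X)) ∧
    (1 - 31 / 20 * machineEps p) * (1 - machineEps p ^ t / 2) * (1 - ‖x‖ ^ 2)
      ≤ fpeValue ((exactListRoutines p t).runSub fl (fpeOfFloat t 1)
          ((exactListRoutines p t).runSqNorm fl X)) ∧
    fpeValue ((exactListRoutines p t).runSub fl (fpeOfFloat t 1)
          ((exactListRoutines p t).runSqNorm fl X))
      ≤ (1 + 31 / 20 * machineEps p) * (1 + machineEps p ^ t / 2) * (1 - ‖x‖ ^ 2) := by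
  have one : IsFloat p 1 := by simpa using IsFloat.zpow (by omega : 1 ≤ p) 0
  have hN := isFPE_runSqNorm (t := t) hfl hp fun i => (hX i).1
  refine ⟨isFPE_runSub hfl hp (.fpeOfFloat one) hN, ?_⟩
  have h1 := runSub_error hfl hp ht (.fpeOfFloat one) hN
  obtain ⟨h2, h3⟩ := runSqNorm_bounds (t := t) hfl hp ht fun i => (hX i).1
  rw [fpeValue_fpeOfFloat (by omega)] at h1
  generalize fpeValue ((exactListRoutines p t).runSqNorm fl X) = N at *
  generalize fpeValue ((exactListRoutines p t).runSub fl (fpeOfFloat t 1)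
    ((exactListRoutines p t).runSqNorm fl X)) = A' at *
  have h4 := hX.norm_pointOf_sub_le
  have h5 := norm_sub_norm_le (pointOf X) x
  have h6 := norm_sub_norm_le x (pointOf X)
  rw [norm_sub_rev] at h6
  have hr := norm_nonneg x
  have hr' := norm_nonneg (pointOf X)
  have hε := machineEps_pos p
  have hε8 := machineEps_le hp
  have hte : machineEps p ^ t = machineEps p * machineEps p ^ (t - 1) := by
    rw [← pow_succ']; congr 1; omega
  have ha : 0 < machineEps p ^ (t - 1) := by positivity
  have ha8 : machineEps p ^ (t - 1) ≤ 1 / 8 :=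
    (pow_le_of_le_one hε.le (by linarith) (by omega)).trans hε8
  generalize ‖x‖ = r at *
  generalize ‖pointOf X‖ = r' at *
  generalize ‖pointOf X - x‖ = δ at *
  rw [hte] at h1 h2 h3 h4 ⊢
  generalize machineEps p ^ (t - 1) = a at *
  generalize machineEps p = ε at *
  have he : 0 < ε * a := by positivity
  have he64 : ε * a ≤ 1 / 64 := by
    calc ε * a ≤ 1 / 8 * (1 / 8) := by gcongr
      _ = 1 / 64 := by norm_num
  have har : ε * a * r ^ 2 ≤ ε / 2 * (1 - r ^ 2) := by
    have : (2 * a + 1) * r ^ 2 ≤ 1 := by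
      have : r ^ 2 ≤ (1 - a) ^ 2 := by gcongr
      calc (2 * a + 1) * r ^ 2 ≤ (2 * a + 1) * (1 - a) ^ 2 := by gcongr
        _ ≤ 1 := by nlinarith [mul_pos ha ha]
    nlinarith
  generalize ε * a = e at *
  have hru : r' ^ 2 ≤ (1 + e) ^ 2 * r ^ 2 := by
    rw [← mul_pow]; gcongr; linarith
  have hrl : (1 - e) ^ 2 * r ^ 2 ≤ r' ^ 2 := by
    rw [← mul_pow]
    have : 0 ≤ (1 - e) * r := mul_nonneg (by linarith) hr
    gcongr
    linarith
  have hNu : N ≤ (1 + 31 / 10 * e) * r ^ 2 := by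
    calc N ≤ (1 + e / 2) ^ 2 * ((1 + e) ^ 2 * r ^ 2) := h3.trans (by gcongr)
      _ = ((1 + e / 2) * (1 + e)) ^ 2 * r ^ 2 := by ring
      _ ≤ (1 + 31 / 10 * e) * r ^ 2 := by
        have : (1 + e / 2) * (1 + e) ≤ 1 + 38 / 25 * e := by nlinarith
        have : ((1 + e / 2) * (1 + e)) ^ 2 ≤ (1 + 38 / 25 * e) ^ 2 := by gcongr
        have : (1 + 38 / 25 * e) ^ 2 ≤ 1 + 31 / 10 * e := by nlinarith
        gcongr
        linarith
  have hNl : (1 - 31 / 10 * e) * r ^ 2 ≤ N := by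
    calc (1 - 31 / 10 * e) * r ^ 2 ≤ ((1 - e / 2) * (1 - e)) ^ 2 * r ^ 2 := by
          have : 1 - 3 / 2 * e ≤ (1 - e / 2) * (1 - e) := by nlinarith
          have : (1 - 3 / 2 * e) ^ 2 ≤ ((1 - e / 2) * (1 - e)) ^ 2 := by
            have : 0 ≤ 1 - 3 / 2 * e := by linarith
            gcongr
          gcongr
          nlinarith
      _ = (1 - e / 2) ^ 2 * ((1 - e) ^ 2 * r ^ 2) := by ring
      _ ≤ N := le_trans (by gcongr) h2
  have hA : 0 ≤ 1 - r ^ 2 := by nlinarith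
  have hl : (1 - 31 / 20 * ε) * (1 - r ^ 2) ≤ 1 - N := by linarith
  have hu : 1 - N ≤ (1 + 31 / 20 * ε) * (1 - r ^ 2) := by linarith
  have hN0 : 0 ≤ 1 - N := le_trans (mul_nonneg (by linarith) hA) hl
  rw [abs_of_nonneg hN0, abs_le] at h1
  have h7 := mul_le_mul_of_nonneg_left hl (by linarith : 0 ≤ 1 - e / 2)
  have h8 := mul_le_mul_of_nonneg_left hu (by linarith : 0 ≤ 1 + e / 2)
  constructor <;> linarith

theorem runSqNorm_sub_bounds (hfl : IsRoundToNearest p fl) (hp : 4 ≤ p) (ht : 2 ≤ t)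
    {X Y : Fin n → Fin t → ℝ} (hX : ∀ i, IsFPE p (X i)) (hY : ∀ i, IsFPE p (Y i)) :
    let V := fun i => (exactListRoutines p t).runSub fl (X i) (Y i)
    (1 - machineEps p ^ t / 2) ^ 4 * ‖pointOf X - pointOf Y‖ ^ 2
        ≤ fpeValue ((exactListRoutines p t).runSqNorm fl V) ∧
      fpeValue ((exactListRoutines p t).runSqNorm fl V)
        ≤ (1 + machineEps p ^ t / 2) ^ 4 * ‖pointOf X - pointOf Y‖ ^ 2 := by
  intro V
  obtain ⟨h1, h2⟩ := runSqNorm_bounds (M := V) hfl hp ht fun i =>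
    isFPE_runSub hfl hp (hX i) (hY i)
  have hε := machineEps_pos p
  have he1 : machineEps p ^ t ≤ 1 := pow_le_one₀ hε.le (machineEps_le_one (by omega))
  have he0 : 0 < machineEps p ^ t := by positivity
  have h3 : ‖pointOf V - (pointOf X - pointOf Y)‖
      ≤ machineEps p ^ t / 2 * ‖pointOf X - pointOf Y‖ :=
    norm_le_mul_of_abs_le (by positivity) fun i => runSub_error hfl hp ht (hX i) (hY i)
  have h4 := norm_sub_norm_le (pointOf V) (pointOf X - pointOf Y)
  have h5 := norm_sub_norm_le (pointOf X - pointOf Y) (pointOf V)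
  rw [norm_sub_rev _ (pointOf V)] at h5
  have hD := norm_nonneg (pointOf X - pointOf Y)
  generalize ‖pointOf X - pointOf Y‖ = D at *
  generalize machineEps p ^ t = e at *
  have h6 : 0 ≤ 1 - e / 2 := by linarith
  constructor
  · calc (1 - e / 2) ^ 4 * D ^ 2 = (1 - e / 2) ^ 2 * ((1 - e / 2) * D) ^ 2 := by ring
      _ ≤ (1 - e / 2) ^ 2 * ‖pointOf V‖ ^ 2 := by gcongr; linarith
      _ ≤ _ := h1
  · calc _ ≤ (1 + e / 2) ^ 2 * ‖pointOf V‖ ^ 2 := h2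
      _ ≤ (1 + e / 2) ^ 2 * ((1 + e / 2) * D) ^ 2 := by gcongr; linarith
      _ = (1 + e / 2) ^ 4 * D ^ 2 := by ring

end exactListRoutines

end

theorem theorem2 (p t : ℕ) (hp : 4 ≤ p) (ht : 1 ≤ t) :
    ∃ 𝓡 : FPERoutines t, 𝓡.IsAccurate p ∧
      ∀ fl : ℝ → ℝ, IsRoundToNearest p fl →
      ∀ (n : ℕ) (x y : EuclideanSpace ℝ (Fin n)) (X Y : Fin n → Fin t → ℝ),
        ‖x‖ < 1 - machineEps p ^ (t - 1) → ‖y‖ < 1 - machineEps p ^ (t - 1) →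
        IsFPERepr p X x → IsFPERepr p Y y →
        IsFPE p (𝓡.runDistArg fl X Y) ∧
        (∀ j : Fin t, j ≠ ⟨0, ht⟩ →
          |𝓡.runDistArg fl X Y j| < |𝓡.runDistArg fl X Y ⟨0, ht⟩|) ∧
        ∀ (R ε₁ : ℝ) (A : ℝ → ℝ), IsFloatArcosh p R ε₁ A → 2 * poincareArg x y ≤ R →
          |A (𝓡.runDistArg fl X Y ⟨0, ht⟩) - poincareDist x y| < 16 * ε₁ := by
  refine ⟨exactListRoutines p t, exactListRoutines.isAccurate hp ht, ?_⟩
  intro fl hfl n x y X Y hx hy hX hY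
  have hε := machineEps_pos p
  have hε8 := machineEps_le hp
  -- for `t = 1` the hypothesis reads `‖x‖ < 0`
  have ht2 : 2 ≤ t := by
    by_contra h
    obtain rfl : t = 1 := by omega
    simp only [Nat.sub_self, pow_zero, sub_self] at hx
    exact absurd hx (norm_nonneg x).not_gt
  have ha : 0 < machineEps p ^ (t - 1) := by positivity
  have pos : ∀ {z : EuclideanSpace ℝ (Fin n)}, ‖z‖ < 1 - machineEps p ^ (t - 1) →
      0 < 1 - ‖z‖ ^ 2 := fun {z} hz => by nlinarith [norm_nonneg z]
  have one : IsFloat p 1 := by simpa using IsFloat.zpow (by omega : 1 ≤ p) 0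
  have two : IsFloat p 2 := by simpa using IsFloat.zpow (by omega : 1 ≤ p) 1
  obtain ⟨hAf, hA1, hA2⟩ := exactListRoutines.one_sub_sqNorm_bounds hfl hp ht2 hx hX
  obtain ⟨hBf, hB1, hB2⟩ := exactListRoutines.one_sub_sqNorm_bounds hfl hp ht2 hy hY
  obtain ⟨hN1, hN2⟩ := exactListRoutines.runSqNorm_sub_bounds hfl hp ht2
    (fun i => (hX i).1) (fun i => (hY i).1)
  have hVf := fun i => exactListRoutines.isFPE_runSub hfl hp (hX i).1 (hY i).1
  have hNf := exactListRoutines.isFPE_runSqNorm (t := t) hfl hp hVf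
  have hM := exactListRoutines.runMul_error_half hfl hp ht2 (.fpeOfFloat two) hNf
  have hMf := exactListRoutines.isFPE_runMul (t := t) hfl hp (.fpeOfFloat two) hNf
  have hP := exactListRoutines.runMul_error_half hfl hp ht2 hAf hBf
  have hPf := exactListRoutines.isFPE_runMul hfl hp hAf hBf
  rw [fpeValue_fpeOfFloat ht] at hM
  have he8 : machineEps p ^ t ≤ machineEps p / 8 := by
    calc machineEps p ^ t ≤ machineEps p ^ 2 :=
          pow_le_pow_of_le_one hε.le (by linarith) ht2
      _ ≤ machineEps p / 8 := by nlinarith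
  have he0 : 0 < machineEps p ^ t := by positivity
  have hP0 := ne_zero_of_factor_bounds (pos hx) (pos hy) hε8 (by linarith) hA1 hB1 hP
  have hq := exactListRoutines.runDiv_error hfl hp ht hMf hPf hP0
  have hqf := exactListRoutines.isFPE_runDiv hfl hp hMf hPf
  obtain ⟨hq0, hq1, hq2⟩ := quotient_bounds hε hε8 he0.le he8 rfl (pos hx) (pos hy)
    hA1 hA2 hB1 hB2 hN1 hN2 hM hP hq
  have hpair := exactListRoutines.isFPE_pair (.fpeOfFloat one) hqf
  have hzf := exactListRoutines.isFPE_runSum (t := t) hfl hp hpair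
  have hz0 := exactListRoutines.runSum_zero_error hfl hp ht hpair
  have hz1 := exactListRoutines.one_le_runSum_zero hfl hp ht hpair
  simp only [Fin.sum_univ_two, Matrix.cons_val_zero, Matrix.cons_val_one,
    fpeValue_fpeOfFloat ht] at hz0 hz1
  change IsFPE p ((exactListRoutines p t).runDistArg fl X Y) at hzf
  change |_ - (exactListRoutines p t).runDistArg fl X Y ⟨0, ht⟩| ≤ _ at hz0
  change _ → 1 ≤ (exactListRoutines p t).runDistArg fl X Y ⟨0, ht⟩ at hz1
  have hf1 := hz1 (by linarith)
  refine ⟨hzf, fun j hj => ?_, fun R ε₁ A hA hR => ?_⟩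
  · refine (hzf.abs_le_mul_abs_zero (by omega) ht j hj).trans_lt ?_
    have : 0 < |(exactListRoutines p t).runDistArg fl X Y ⟨0, ht⟩| := abs_pos.2 (by linarith)
    nlinarith
  · have hC : 0 < (1 - ‖x‖ ^ 2) * (1 - ‖y‖ ^ 2) := mul_pos (pos hx) (pos hy)
    have hm : 0 < √((1 - ‖x‖ ^ 2) * (1 - ‖y‖ ^ 2)) := Real.sqrt_pos.2 hC
    have hm2 := Real.sq_sqrt hC.le
    have hD := abs_norm_pointOf_sub_le ht2 hx hy hX hY
    have hz : poincareArg x y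
        = 1 + 2 * (‖x - y‖ / √((1 - ‖x‖ ^ 2) * (1 - ‖y‖ ^ 2))) ^ 2 := by
      rw [poincareArg, div_pow, hm2]
    obtain ⟨h1, h2⟩ := leading_term_bounds (w := ‖x - y‖ / √((1 - ‖x‖ ^ 2) * (1 - ‖y‖ ^ 2)))
      (w' := ‖pointOf X - pointOf Y‖ / √((1 - ‖x‖ ^ 2) * (1 - ‖y‖ ^ 2))) hε hε8
      (by positivity) (by positivity)
      (by rwa [← sub_div, abs_div, abs_of_pos hm, div_le_iff₀ hm]) hq0
      (by rwa [div_pow, hm2, ← mul_div_assoc, div_le_iff₀ hC])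
      (by rwa [div_pow, hm2, ← mul_div_assoc, le_div_iff₀ hC]) hz0
    rw [← hz] at h1 h2
    have hz1 : 1 ≤ poincareArg x y := by
      rw [hz, le_add_iff_nonneg_right]
      positivity
    refine hA.abs_sub_lt (by omega) hz1 hR (hzf.1 _) hf1 ?_ ?_ h2
    · refine h1.trans (le_trans ?_ hR)
      gcongr
      linarith
    · refine h1.trans ?_
      gcongr
      norm_num
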